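/- For $k\in\mathbb C$ let $f_k\in\mathbb C[x_0,x_1,x_2,x_3]$ be the quartic form $$f_k=(1+k)^3x_0^2x_1^2+2k(1-k^2)x_0x_1x_2x_3-(1-k)^3x_2^2x_3^2+(1-k^2)(x_0+x_1+x_2+x_3)\bigl[(1-k)x_2x_3(x_0+x_1)-(1+k)x_0x_1(x_2+x_3)\bigr].$$ Let $S_k\subset\mathbb P^5(\mathbb C)$ be the Bertin–Vanhaecke sextic surface with equations $$x_1+x_2+x_3+x_4+x_5+x_6=0,$$ $$(1+k)(x_1x_2+x_1x_3+x_2x_3)+(1-k)(x_4x_5+x_4x_6+x_5x_6)=0,$$ $$(1+k)^2x_1x_2x_3+(1-k)^2x_4x_5x_6=0,$$ let $c=(1:0:0:-1:0:0)$, and let $\pi$ be the projection from $c$ onto the $3$-plane $x_1=x_4=-\frac12(x_2+x_3+x_5+x_6)$, on which $(x_2:x_3:x_5:x_6)$ are used as homogeneous coordinates, renamed $(x_0:x_1:x_2:x_3)$. A cusp is an $A_2$ double point: a point of a surface at which the analytic germ of the surface is isomorphic to the germ of $\{z_0^3+z_1z_2=0\}\subset\mathbb C^3$ at $0$ (for a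 surface defined by $r$ equations in an $(r+2)$-dimensional space: the ideal of the equations becomes $(z_0^3+z_1z_2,z_3,\dots,z_{r+1})$ in suitable local holomorphic coordinates). Suppose $k\neq\pm1$. Then: 1. The point $c$ is a cusp of $S_k$; $f_k$ is homogeneous of degree $4$, and the surface $\{f_k=0\}\subset\mathbb P^3(\mathbb C)$ is the projection of $S_k$ from $c$, i.e. the Zariski closure of $\pi(S_k\setminus\{c\})$. The eight points other than $c$ among the nine points of $S_k$ that have one of the coordinates $x_1,x_2,x_3$ equal to $1$, one of $x_4,x_5,x_6$ equal to $-1$ and all others $0$ are mapped by $\pi$ onto the eight points in 2. 2. The surface $\{f_k=0\}$ has exactly eight singular points (zeros of $f_k$ at which all partial derivatives of $f_k$ vanish), namely the four coordinate vertices $(1:0:0:0)$, $(0:1:0:0)$, $(0:0:1:0)$, $(0:0:0:1)$ and the four points $(1:0:-1:0)$, $(1:0:0:-1)$, $(0:1:-1:0)$, $(0:1:0:-1)$ in the plane $x_0+x_1+x_2+x_3=0$. 3. Each of these eight points $P$ satisfies the semi-quasihomogeneous criterion: in some standard affine chart containing $P$ there are affine-linear coordinates $u_1,u_2,u_3$ centred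 at $P$ such that, with weights $\mathrm{wt}(u_1)=\frac13$, $\mathrm{wt}(u_2)=\mathrm{wt}(u_3)=\frac12$, the Taylor expansion of the dehomogenized equation $f_k$ contains only monomials of weight $\ge1$ and its weight-$1$ part is $u_1^3+u_2u_3$. Moreover each of these eight points is a cusp ($A_2$ point) of $\{f_k=0\}$. -/

import Mathlib

open MvPolynomial

noncomputable section

/-- The points of the complex projective space `ℙ(ℂⁿ)` with homogeneous coordinate vectors in `V`. -/
def projPoints {n : ℕ} (V : Set (Fin n → ℂ)) : Set (Projectivization ℂ (Fin n → ℂ)) :=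
  {P | ∃ v ∈ V, ∃ hv : v ≠ 0, P = Projectivization.mk ℂ v hv}

/-- Common zeros in projective space of a family of (homogeneous) polynomials. -/
def projZeros {n r : ℕ} (F : Fin r → MvPolynomial (Fin n) ℂ) :
    Set (Projectivization ℂ (Fin n → ℂ)) :=
  {P | ∀ i, eval P.rep (F i) = 0}

/-- The Zariski closure of a set of points of projective space. -/
def zariskiClosure {n : ℕ} (S : Set (Projectivization ℂ (Fin n → ℂ))) :
    Set (Projectivization ℂ (Fin n → ℂ)) :=
  {P | ∀ (d : ℕ) (g : MvPolynomial (Fin n) ℂ), g.IsHomogeneous d →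
    (∀ Q ∈ S, eval Q.rep g = 0) → eval P.rep g = 0}

/-- The singular points of the projective hypersurface `f = 0`, `f` homogeneous: the points of the
hypersurface at which all partial derivatives of `f` vanish. -/
def singularPoints {n : ℕ} (f : MvPolynomial (Fin n) ℂ) :
    Set (Projectivization ℂ (Fin n → ℂ)) :=
  {P | eval P.rep f = 0 ∧ ∀ i, eval P.rep (pderiv i f) = 0}

/-- The coordinates of the point `P` in the affine chart `x_i = 1` (meaningful when the
`i`-th homogeneous coordinate of `P` is not zero). -/
def affineCoord {n : ℕ} (i : Fin (n + 1)) (P : Projectivization ℂ (Fin (n + 1) → ℂ)) :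
    Fin n → ℂ :=
  fun j => P.rep (i.succAbove j) / P.rep i

/-- The equations `z₀³ + z₁z₂ = 0`, `z₃ = ⋯ = z_{r+2} = 0` in `ℂ^{r+3}` of the
`A₂` surface germ at the origin. -/
def a2Model {r : ℕ} (z : Fin (r + 3) → ℂ) : Fin (r + 1) → ℂ :=
  Fin.cons (z 0 ^ 3 + z 1 * z 2) (fun j : Fin r => z (Fin.natAdd 3 j |>.cast (by omega)))

/-- `P` is a cusp, i.e. an `A₂` double point, of the complete intersection surface
`F₀ = ⋯ = F_r = 0` in `ℙ^{r+3}`: in an affine chart around `P` there are local biholomorphic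
coordinates `z` centred at `P` in which the (germ of the) ideal generated by the equations of the
surface is the ideal generated by `z₀³ + z₁z₂, z₃, …, z_{r+2}`, the two systems of generators
being related by an invertible matrix `M` of holomorphic functions.
For a surface in `ℙ³` (`r = 0`) the matrix `M` is just a nowhere vanishing holomorphic function. -/
def IsA2Cusp {r : ℕ} (F : Fin (r + 1) → MvPolynomial (Fin (r + 4)) ℂ)
    (P : Projectivization ℂ (Fin (r + 4) → ℂ)) : Prop :=
  ∃ i : Fin (r + 4), P.rep i ≠ 0 ∧
    ∃ (φ : OpenPartialHomeomorph (Fin (r + 3) → ℂ) (Fin (r + 3) → ℂ))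
      (M : (Fin (r + 3) → ℂ) → Matrix (Fin (r + 1)) (Fin (r + 1)) ℂ),
      0 ∈ φ.source ∧ φ 0 = affineCoord i P ∧
      AnalyticOnNhd ℂ φ φ.source ∧ AnalyticOnNhd ℂ φ.symm φ.target ∧
      (∀ a b, AnalyticOnNhd ℂ (fun z => M z a b) φ.source) ∧
      (∀ z ∈ φ.source, IsUnit (M z)) ∧
      ∀ z ∈ φ.source,
        (fun j => eval (i.insertNth 1 (φ z) : Fin (r + 4) → ℂ) (F j)) =
          (M z).mulVec (a2Model z)

/-- The weights `1/3, 1/2, 1/2` of the coordinates `u₁, u₂, u₃`. -/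
def a2Weights : Fin 3 → ℚ := ![1 / 3, 1 / 2, 1 / 2]

/-- The semi-quasihomogeneous criterion for an `A₂` point of the surface `f = 0` in `ℙ³`
at `P`: in an affine chart around `P` there are linear coordinates `u` centred at `P` (with
`x = a + T u`, where `a` is the coordinate vector of `P` and `T` an invertible matrix) such that
the Taylor expansion of the equation contains only monomials of weight at least `1`,
and its part of weight `1` is `u₁³ + u₂u₃`. -/
def SatisfiesSQHCriterion (f : MvPolynomial (Fin 4) ℂ)
    (P : Projectivization ℂ (Fin 4 → ℂ)) : Prop :=
  ∃ i : Fin 4, P.rep i ≠ 0 ∧ ∃ T : Matrix (Fin 3) (Fin 3) ℂ, IsUnit T ∧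
    ∃ g : MvPolynomial (Fin 3) ℂ,
      g = aeval (i.insertNth 1
            (fun j : Fin 3 => C (affineCoord i P j) + ∑ l, C (T j l) * X l) :
              Fin 4 → MvPolynomial (Fin 3) ℂ) f ∧
      (∀ m ∈ g.support, 1 ≤ Finsupp.weight a2Weights m) ∧
      weightedHomogeneousComponent a2Weights 1 g = X 0 ^ 3 + X 1 * X 2

/-- The equations of the Bertin–Vanhaecke sextic in `ℙ⁵`: the hyperplane, the quadric and the
cubic. The coordinates `x₁, …, x₆` are numbered `0, …, 5`. -/
def sexticForms (k : ℂ) : Fin 3 → MvPolynomial (Fin 6) ℂ :=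
  ![X 0 + X 1 + X 2 + X 3 + X 4 + X 5,
    C (1 + k) * (X 0 * X 1 + X 0 * X 2 + X 1 * X 2)
      + C (1 - k) * (X 3 * X 4 + X 3 * X 5 + X 4 * X 5),
    C ((1 + k) ^ 2) * (X 0 * X 1 * X 2) + C ((1 - k) ^ 2) * (X 3 * X 4 * X 5)]

/-- The coordinate vector of the centre of projection. -/
def centreVec : Fin 6 → ℂ := ![1, 0, 0, -1, 0, 0]

theorem centreVec_ne_zero : centreVec ≠ 0 := fun h => by
  simpa [centreVec] using congrFun h 0

/-- The centre of projection `(1 : 0 : 0 : -1 : 0 : 0)`. -/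
def centre : Projectivization ℂ (Fin 6 → ℂ) := Projectivization.mk ℂ centreVec centreVec_ne_zero

/-- The nine points of `ℙ⁵` with one of the first three coordinates equal to `1`, one of the last
three coordinates equal to `-1` and all others `0`. -/
def ninePoints : Set (Projectivization ℂ (Fin 6 → ℂ)) :=
  projPoints {v | ∃ i j : Fin 3,
    v = Pi.single (Fin.castAdd 3 i) 1 - Pi.single (Fin.natAdd 3 j) 1}

/-- The parametrization of the `3`-plane `x₁ = x₄ = -(x₂ + x₃ + x₅ + x₆)/2` in `ℙ⁵` by the
coordinates `(x₂ : x₃ : x₅ : x₆)`, here named `y₀, …, y₃`. -/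
def planeVec (y : Fin 4 → ℂ) : Fin 6 → ℂ :=
  ![-(y 0 + y 1 + y 2 + y 3) / 2, y 0, y 1, -(y 0 + y 1 + y 2 + y 3) / 2, y 2, y 3]

/-- The image of `S`, without the centre, under projection from `centre` onto the `3`-plane above:
the points `y` of the plane such that the line joining `centre` to `y` contains a point
of `S` other than `centre`. -/
def projectFromCentre (S : Set (Projectivization ℂ (Fin 6 → ℂ))) :
    Set (Projectivization ℂ (Fin 4 → ℂ)) :=
  {y | ∃ x ∈ S, x ≠ centre ∧ x.submodule ≤ Submodule.span ℂ {centreVec, planeVec y.rep}}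

/-- The quartic form `f_k`. -/
def quartic (k : ℂ) : MvPolynomial (Fin 4) ℂ :=
  C ((1 + k) ^ 3) * (X 0 ^ 2 * X 1 ^ 2) + C (2 * k * (1 - k ^ 2)) * (X 0 * X 1 * X 2 * X 3)
    - C ((1 - k) ^ 3) * (X 2 ^ 2 * X 3 ^ 2)
    + C (1 - k ^ 2) * (X 0 + X 1 + X 2 + X 3) *
      (C (1 - k) * (X 2 * X 3 * (X 0 + X 1)) - C (1 + k) * (X 0 * X 1 * (X 2 + X 3)))

/-- The four coordinate vertices and the four points `(1:0:-1:0)`, `(1:0:0:-1)`, `(0:1:-1:0)`,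
`(0:1:0:-1)`. -/
def eightPoints : Set (Projectivization ℂ (Fin 4 → ℂ)) :=
  projPoints {![1, 0, 0, 0], ![0, 1, 0, 0], ![0, 0, 1, 0], ![0, 0, 0, 1],
    ![1, 0, -1, 0], ![1, 0, 0, -1], ![0, 1, -1, 0], ![0, 1, 0, -1]}

end

/-! Put a = 1+k and b = 1-k, both nonzero, with a+b = 2. On the hyperplane x₄ = -x₁-s, where s =
x₂+x₃+x₅+x₆, so the quadric and the cubic have degree at most one in x₁. Up to sign f_k is their
resultant (`eval_quartic_eq_resultant`), hence it vanishes on the projection. A zero of f_k lifts to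
the sextic wherever `tangentForm`, the coefficient of x₁ in the quadric, is nonzero; the
Nullstellensatz and the coprimality of `tangentForm` and f_k give the closure.

At (1:0:0:0) and (1:0:-1:0) the quadratic part of the equation is a product of two independent
linear forms, and the cubic part does not vanish along their common kernel. Rescaling gives u₁³+u₂u₃
plus heavier monomials, and symmetries carry this to all eight points. `exists_a2_local_form` then
completes the square and factors the quadratic form analytically; the inverse function theorem
supplies the coordinates.

The sextic is symmetric in x₁, x₂, x₃. Eliminating x₂ instead of x₁ produces the same quartic, but
now c lies over the vertex (1:0:0:0), whose normal form lifts to c.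

For the singular locus, ∂₀f-∂₁f = (x₁-x₀)F and ∂₂f-∂₃f = (x₃-x₂)G. Each of the four resulting cases
forces x₀x₁ = x₂x₃ = 0 and (x₀+x₁+x₂+x₃)(x₀+x₁)(x₂+x₃) = 0, equations that cut out the eight points.
-/

open MvPolynomial

noncomputable section

/-! ### Analytic normal forms of A₂ germs -/

open Filter Topology Matrix in
/-- A surface germ whose equations are, up to an invertible analytic matrix, the `A₂` model pulled
back along an analytic map with invertible derivative is a cusp. -/
theorem isA2Cusp_of_analyticAt {r : ℕ} {F : Fin (r + 1) → MvPolynomial (Fin (r + 4)) ℂ}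
    {P : Projectivization ℂ (Fin (r + 4) → ℂ)} (i : Fin (r + 4)) (hi : P.rep i ≠ 0)
    {p : Fin (r + 3) → ℂ} (hp : affineCoord i P = p)
    (Ψ : (Fin (r + 3) → ℂ) → (Fin (r + 3) → ℂ))
    (N : (Fin (r + 3) → ℂ) → Matrix (Fin (r + 1)) (Fin (r + 1)) ℂ)
    (hΨ : AnalyticAt ℂ Ψ p) (h0 : Ψ p = 0)
    (hinj : Function.Injective (fderiv ℂ Ψ p))
    (hN : ∀ a b, AnalyticAt ℂ (fun x => N x a b) p) (hU : IsUnit (N p))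
    (hF : ∀ᶠ x in 𝓝 p, (fun j => eval (i.insertNth 1 x : Fin (r + 4) → ℂ) (F j)) =
      (N x).mulVec (a2Model (Ψ x))) :
    IsA2Cusp F P := by
  subst hp
  set p := affineCoord i P
  let D : (Fin (r + 3) → ℂ) ≃L[ℂ] (Fin (r + 3) → ℂ) :=
    (LinearEquiv.ofInjectiveEndo (fderiv ℂ Ψ p : (Fin (r + 3) → ℂ) →ₗ[ℂ] _)
      hinj).toContinuousLinearEquiv
  have hD : (D : (Fin (r + 3) → ℂ) →L[ℂ] (Fin (r + 3) → ℂ)) = fderiv ℂ Ψ p := by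
    ext1 x; rfl
  have hs : HasStrictFDerivAt Ψ (D : (Fin (r + 3) → ℂ) →L[ℂ] (Fin (r + 3) → ℂ)) p := by
    rw [hD]; exact hΨ.hasStrictFDerivAt
  let e := hs.toOpenPartialHomeomorph Ψ
  have he : ⇑e = Ψ := hs.toOpenPartialHomeomorph_coe
  have hpe : p ∈ e.source := hs.mem_toOpenPartialHomeomorph_source
  have hep : e p = 0 := by rw [he, h0]
  have hsymm0 : e.symm 0 = p := by rw [← hep]; exact e.left_inv hpe
  have h0t : (0 : Fin (r + 3) → ℂ) ∈ e.target := by rw [← hep]; exact e.map_source hpe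
  have hdet : ∀ᶠ x in 𝓝 p, IsUnit (N x) := by
    have hc : ContinuousAt (fun x => (N x).det) p := by
      have : ContinuousAt N p :=
        continuousAt_pi.2 fun a => continuousAt_pi.2 fun b => (hN a b).continuousAt
      exact (continuous_id.matrix_det.continuousAt).comp this
    have := hc.eventually_ne ((Matrix.isUnit_iff_isUnit_det _).1 hU).ne_zero
    filter_upwards [this] with x hx
    exact (Matrix.isUnit_iff_isUnit_det _).2 (isUnit_iff_ne_zero.2 hx)
  have hNan : ∀ᶠ x in 𝓝 p, ∀ a b, AnalyticAt ℂ (fun x => N x a b) x := by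
    rw [eventually_all]; intro a
    rw [eventually_all]; intro b
    exact (hN a b).eventually_analyticAt
  have hsan : AnalyticAt ℂ e.symm 0 := by
    refine e.analyticAt_symm (i := D) h0t ?_ ?_
    · rw [hsymm0, he]; exact hΨ
    · rw [hsymm0, he, hD]
  have hcont : Tendsto e.symm (𝓝 0) (𝓝 p) := by
    have := hsan.continuousAt.tendsto
    rwa [hsymm0] at this
  have hall := (hcont.eventually (hF.and (hdet.and (hNan.and hΨ.eventually_analyticAt)))).and
    hsan.eventually_analyticAt
  set V := {z | ((fun j => eval (i.insertNth 1 (e.symm z) : Fin (r + 4) → ℂ) (F j)) =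
      (N (e.symm z)).mulVec (a2Model (Ψ (e.symm z))) ∧ IsUnit (N (e.symm z)) ∧
      (∀ a b, AnalyticAt ℂ (fun x => N x a b) (e.symm z)) ∧ AnalyticAt ℂ Ψ (e.symm z)) ∧
      AnalyticAt ℂ e.symm z}
  have hV : V ∈ 𝓝 (0 : Fin (r + 3) → ℂ) := hall
  -- The chart is the local inverse of Ψ, cut down to the interior of V so that the conditions known
  -- near the point hold on its whole source.
  let φ := e.symm.restr V
  have hφs : ∀ z ∈ φ.source, z ∈ e.target ∧ z ∈ V := by
    intro z hz
    rw [OpenPartialHomeomorph.restr_source] at hz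
    exact ⟨hz.1, interior_subset hz.2⟩
  refine ⟨i, hi, φ, fun z => N (e.symm z), ?_, hsymm0, ?_, ?_, ?_, ?_, ?_⟩
  · rw [OpenPartialHomeomorph.restr_source]
    exact ⟨h0t, mem_interior_iff_mem_nhds.2 hV⟩
  · intro z hz
    exact (hφs z hz).2.2
  · intro x hx
    have h1 : φ.symm x ∈ φ.source := φ.map_target hx
    have h2 := (hφs _ h1).2.1.2.2.2
    have h3 : e.symm (φ.symm x) = x := φ.right_inv hx
    rw [h3] at h2
    change AnalyticAt ℂ (⇑e) x
    rwa [he]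
  · intro a b z hz
    exact ((hφs z hz).2.1.2.2.1 a b).comp (hφs z hz).2.2
  · intro z hz
    exact (hφs z hz).2.1.2.1
  · intro z hz
    have h1 := (hφs z hz).2.1.1
    have h2 : Ψ (e.symm z) = z := by rw [← he]; exact e.right_inv (hφs z hz).1
    rw [h2] at h1
    exact h1

section

open Filter Topology Matrix

/-- A map of the form `u ↦ m(u) u` has derivative `m(0)` at the origin. -/
theorem hasFDerivAt_mulVec_self {n : ℕ} {m : (Fin n → ℂ) → Matrix (Fin n) (Fin n) ℂ}
    (hm : ∀ i j, DifferentiableAt ℂ (fun u => m u i j) 0) :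
    HasFDerivAt (fun u => m u *ᵥ u) (LinearMap.toContinuousLinearMap (m 0).mulVecLin) 0 := by
  rw [hasFDerivAt_pi']
  intro i
  have h : ∀ j ∈ Finset.univ, HasFDerivAt (fun u : Fin n → ℂ => m u i j * u j) _ 0 := fun j _ =>
    (hm i j).hasFDerivAt.mul (hasFDerivAt_apply (𝕜 := ℂ) j (0 : Fin n → ℂ))
  have h2 := HasFDerivAt.fun_sum h
  refine (h2.congr_fderiv ?_)
  ext v
  simp [Matrix.mulVec, dotProduct]

/-- Analytic square root of a function with value `1/4`, with value `1/2`. -/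
theorem exists_analyticAt_sqrt {E : Type*} [NormedAddCommGroup E] [NormedSpace ℂ E]
    {f : E → ℂ} {x : E} (hf : AnalyticAt ℂ f x) (hx : f x = 1 / 4) :
    ∃ d : E → ℂ, AnalyticAt ℂ d x ∧ d x = 1 / 2 ∧ ∀ᶠ y in 𝓝 x, d y ^ 2 = f y := by
  have h4 : ∀ᶠ y in 𝓝 x, f y ≠ 0 := hf.continuousAt.eventually_ne (by rw [hx]; norm_num)
  -- Since 4f = 1 at x, the logarithm is taken away from its branch cut.
  refine ⟨fun y => 1 / 2 * Complex.exp (Complex.log (4 * f y) / 2), ?_, ?_, ?_⟩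
  · refine analyticAt_const.mul (AnalyticAt.cexp' (AnalyticAt.div
      (AnalyticAt.clog (analyticAt_const.mul hf) ?_) analyticAt_const two_ne_zero))
    rw [hx]; norm_num
  · simp [hx]
  · filter_upwards [h4] with y hy
    rw [mul_pow, ← Complex.exp_nat_mul]
    have : ((2 : ℕ) : ℂ) * (Complex.log (4 * f y) / 2) = Complex.log (4 * f y) := by
      push_cast; ring
    rw [this, Complex.exp_log (by simpa using hy)]
    ring

/-- Local normal form of a semi-quasihomogeneous function with principal part
`u₀³ + u₁u₂`. -/
theorem exists_a2_local_form {U L M α β γ : (Fin 3 → ℂ) → ℂ}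
    (hU : AnalyticAt ℂ U 0) (hL : AnalyticAt ℂ L 0) (hM : AnalyticAt ℂ M 0)
    (hα : AnalyticAt ℂ α 0) (hβ : AnalyticAt ℂ β 0) (hγ : AnalyticAt ℂ γ 0)
    (hU0 : U 0 = 1) (hα0 : α 0 = 0) (hβ0 : β 0 = 1 / 2) (hγ0 : γ 0 = 0) :
    ∃ (Ψ : (Fin 3 → ℂ) → (Fin 3 → ℂ)) (N : (Fin 3 → ℂ) → ℂ),
      AnalyticAt ℂ Ψ 0 ∧ Ψ 0 = 0 ∧ Function.Injective (fderiv ℂ Ψ 0) ∧ AnalyticAt ℂ N 0 ∧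
      N 0 ≠ 0 ∧ ∀ᶠ u in 𝓝 0, u 0 ^ 3 * U u + u 0 ^ 2 * (L u * u 1 + M u * u 2)
        + (α u * u 1 ^ 2 + 2 * β u * (u 1 * u 2) + γ u * u 2 ^ 2) =
        N u * (Ψ u 0 ^ 3 + Ψ u 1 * Ψ u 2) := by
  -- δ² is minus the determinant of the quadratic form with matrix (α β; β γ).
  obtain ⟨δ, hδ, hδ0, hδ2⟩ := exists_analyticAt_sqrt (f := fun u => β u ^ 2 - α u * γ u)
    ((hβ.pow 2).sub (hα.mul hγ)) (by rw [hα0, hβ0]; norm_num)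
  have hproj : ∀ i : Fin 3, AnalyticAt ℂ (fun u : Fin 3 → ℂ => u i) 0 := fun i =>
    (ContinuousLinearMap.proj (R := ℂ) (φ := fun _ : Fin 3 => ℂ) i).analyticAt 0
  -- Cramer's solution of 2(αh₁+βh₂) = L, 2(βh₁+γh₂) = M: the shifts vᵢ = uᵢ+u₀²hᵢ absorb the terms
  -- u₀²(Lu₁+Mu₂), leaving a multiple of u₀⁴ that goes into W.
  let h₁ : (Fin 3 → ℂ) → ℂ := fun u => (β u * M u - γ u * L u) / (2 * δ u ^ 2)
  let h₂ : (Fin 3 → ℂ) → ℂ := fun u => (β u * L u - α u * M u) / (2 * δ u ^ 2)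
  -- s is a root of s²-2βs+αγ, so s(αv₁²+2βv₁v₂+γv₂²) = (sv₁+γv₂)(αv₁+sv₂).
  let s : (Fin 3 → ℂ) → ℂ := fun u => β u + δ u
  let W : (Fin 3 → ℂ) → ℂ := fun u =>
    U u - u 0 * (α u * h₁ u ^ 2 + 2 * β u * (h₁ u * h₂ u) + γ u * h₂ u ^ 2)
  have hδd : (2 * δ 0 ^ 2 : ℂ) ≠ 0 := by rw [hδ0]; norm_num
  have hδa : AnalyticAt ℂ (fun u => 2 * δ u ^ 2) 0 := analyticAt_const.mul (hδ.pow 2)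
  have hh₁ : AnalyticAt ℂ h₁ 0 := ((hβ.mul hM).sub (hγ.mul hL)).div hδa hδd
  have hh₂ : AnalyticAt ℂ h₂ 0 := ((hβ.mul hL).sub (hα.mul hM)).div hδa hδd
  have hs : AnalyticAt ℂ s 0 := hβ.add hδ
  have hs0 : s 0 = 1 := by simp only [s, hβ0, hδ0]; norm_num
  have hW : AnalyticAt ℂ W 0 := hU.sub ((hproj 0).mul (((hα.mul (hh₁.pow 2)).add
    ((analyticAt_const.mul hβ).mul (hh₁.mul hh₂))).add (hγ.mul (hh₂.pow 2))))
  have hW0 : W 0 = 1 := by simp [W, hU0]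
  have hsW : AnalyticAt ℂ (fun u => s u * W u) 0 := hs.mul hW
  have hsW0 : s 0 * W 0 ≠ 0 := by rw [hs0, hW0]; norm_num
  -- The new coordinates are u₀ and the two factors, the second divided by sW so that W becomes a
  -- common factor. In the form m(u)u their derivative at 0 is m(0) = 1.
  let m : (Fin 3 → ℂ) → Matrix (Fin 3) (Fin 3) ℂ := fun u =>
    !![1, 0, 0;
       u 0 * (s u * h₁ u + γ u * h₂ u), s u, γ u;
       u 0 * (α u * h₁ u + s u * h₂ u) / (s u * W u), α u / (s u * W u), s u / (s u * W u)]
  have hm : ∀ i j, AnalyticAt ℂ (fun u => m u i j) 0 := by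
    intro i j
    fin_cases i <;> fin_cases j
    · exact analyticAt_const
    · exact analyticAt_const
    · exact analyticAt_const
    · exact (hproj 0).mul ((hs.mul hh₁).add (hγ.mul hh₂))
    · exact hs
    · exact hγ
    · exact ((hproj 0).mul ((hα.mul hh₁).add (hs.mul hh₂))).div hsW hsW0
    · exact hα.div hsW hsW0
    · exact hs.div hsW hsW0
  have hm0 : m 0 = 1 := by
    ext i j
    fin_cases i <;> fin_cases j <;> simp [m, hs0, hW0, hα0, hγ0]
  have hd := hasFDerivAt_mulVec_self fun i j => (hm i j).differentiableAt
  refine ⟨fun u => m u *ᵥ u, W, ?_, by simp, ?_, hW, by rw [hW0]; exact one_ne_zero, ?_⟩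
  · rw [analyticAt_pi_iff]
    intro i
    have : (fun u => (m u *ᵥ u) i) = fun u => ∑ j, m u i j * u j := rfl
    rw [this]
    exact Finset.analyticAt_fun_sum _ fun j _ => (hm i j).mul (hproj j)
  · rw [hd.fderiv, hm0]
    intro x y hxy
    simpa using hxy
  · have e1 : ∀ᶠ u in 𝓝 (0 : Fin 3 → ℂ), s u * W u ≠ 0 := hsW.continuousAt.eventually_ne hsW0
    have e2 : ∀ᶠ u in 𝓝 (0 : Fin 3 → ℂ), 2 * δ u ^ 2 ≠ 0 := hδa.continuousAt.eventually_ne hδd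
    filter_upwards [e1, e2, hδ2] with u hu1 hu2 hu3
    have hsu : s u ≠ 0 := left_ne_zero_of_mul hu1
    have hWu : W u ≠ 0 := right_ne_zero_of_mul hu1
    have hδu : δ u ≠ 0 := fun h => hu2 (by rw [h]; ring)
    have k1 : 2 * (α u * h₁ u + β u * h₂ u) = L u := by
      have : (α u * h₁ u + β u * h₂ u) = (β u ^ 2 - α u * γ u) * L u / (2 * δ u ^ 2) := by
        simp only [h₁, h₂]; ring
      rw [this, ← hu3]; field_simp
    have k2 : 2 * (β u * h₁ u + γ u * h₂ u) = M u := by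
      have : (β u * h₁ u + γ u * h₂ u) = (β u ^ 2 - α u * γ u) * M u / (2 * δ u ^ 2) := by
        simp only [h₁, h₂]; ring
      rw [this, ← hu3]; field_simp
    have hs2 : s u ^ 2 + α u * γ u = 2 * β u * s u := by
      simp only [s]; linear_combination hu3
    have hWe : U u = W u + u 0 * (α u * h₁ u ^ 2 + 2 * β u * (h₁ u * h₂ u) + γ u * h₂ u ^ 2) := by
      simp only [W]; ring
    have p0 : (m u *ᵥ u) 0 = u 0 := by simp [m, Matrix.mulVec, dotProduct, Fin.sum_univ_three]
    have p1 : (m u *ᵥ u) 1 = s u * (u 1 + u 0 ^ 2 * h₁ u) + γ u * (u 2 + u 0 ^ 2 * h₂ u) := by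
      simp [m, Matrix.mulVec, dotProduct, Fin.sum_univ_three]; ring
    have p2 : (m u *ᵥ u) 2 = (α u * (u 1 + u 0 ^ 2 * h₁ u) + s u * (u 2 + u 0 ^ 2 * h₂ u)) /
        (s u * W u) := by
      simp [m, Matrix.mulVec, dotProduct, Fin.sum_univ_three]; ring
    rw [p0, p1, p2, hWe, ← k1, ← k2]
    generalize h₁ u = g₁ at *
    generalize h₂ u = g₂ at *
    generalize W u = w at *
    generalize s u = t at *
    field_simp
    linear_combination (-(u 1 + u 0 ^ 2 * g₁) * (u 2 + u 0 ^ 2 * g₂)) * hs2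

end

/-! ### Weights and the semi-quasihomogeneous criterion -/

section

open Filter Topology Matrix

/-- The ideal of polynomials all of whose monomials have weight greater than `1`. -/
def heavyIdeal : Ideal (MvPolynomial (Fin 3) ℂ) :=
  Ideal.span ((fun m => monomial m 1) '' {m : Fin 3 →₀ ℕ | 1 < Finsupp.weight a2Weights m})

theorem weight_a2Weights (m : Fin 3 →₀ ℕ) :
    Finsupp.weight a2Weights m = m 0 / 3 + m 1 / 2 + m 2 / 2 := by
  rw [Finsupp.weight_apply, Finsupp.sum_fintype _ _ (by simp)]
  simp [Fin.sum_univ_three, a2Weights]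
  ring

/-- The weights are positive, so every multiple of a heavy monomial is heavy. -/
theorem mem_heavyIdeal {p : MvPolynomial (Fin 3) ℂ} :
    p ∈ heavyIdeal ↔ ∀ m ∈ p.support, 1 < Finsupp.weight a2Weights m := by
  rw [heavyIdeal, mem_ideal_span_monomial_image]
  refine forall₂_congr fun m _ => ⟨?_, fun h => ⟨m, h, le_rfl⟩⟩
  rintro ⟨s, hs, hsm⟩
  refine lt_of_lt_of_le hs ?_
  rw [weight_a2Weights, weight_a2Weights]
  have h0 : (s 0 : ℚ) ≤ m 0 := by exact_mod_cast hsm 0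
  have h1 : (s 1 : ℚ) ≤ m 1 := by exact_mod_cast hsm 1
  have h2 : (s 2 : ℚ) ≤ m 2 := by exact_mod_cast hsm 2
  linarith

theorem monomial_eq_prod_three (m : Fin 3 →₀ ℕ) :
    (monomial m 1 : MvPolynomial (Fin 3) ℂ) = X 0 ^ m 0 * X 1 ^ m 1 * X 2 ^ m 2 := by
  rw [monomial_eq, Finsupp.prod_fintype _ _ (by simp), Fin.prod_univ_three]
  simp

/-- This is the input shape of `exists_a2_local_form`. The monomials X₀³, X₁², X₁X₂, X₂² have weight
exactly 1, so their cofactors have no constant term; X₀²X₁ and X₀²X₂ are already heavy, so L and M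
are free. -/
theorem exists_decomposition_of_mem_heavyIdeal {p : MvPolynomial (Fin 3) ℂ}
    (hp : p ∈ heavyIdeal) :
    ∃ U L M α β γ : MvPolynomial (Fin 3) ℂ,
      constantCoeff U = 0 ∧ constantCoeff α = 0 ∧ constantCoeff β = 0 ∧ constantCoeff γ = 0 ∧
      p = X 0 ^ 3 * U + X 0 ^ 2 * (L * X 1 + M * X 2)
        + (α * X 1 ^ 2 + β * (X 1 * X 2) + γ * X 2 ^ 2) := by
  induction hp using Submodule.span_induction with
  | mem x hx =>
    obtain ⟨m, hm, rfl⟩ := hx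
    simp only [Set.mem_ofPred_eq, weight_a2Weights] at hm
    have hm' : 6 < 2 * m 0 + 3 * m 1 + 3 * m 2 := by
      have : (6 : ℚ) < 2 * m 0 + 3 * m 1 + 3 * m 2 := by linarith
      exact_mod_cast this
    simp only [monomial_eq_prod_three]
    generalize m 0 = i at *
    generalize m 1 = j at *
    generalize m 2 = l at *
    rcases j with _ | _ | j
    · rcases l with _ | _ | l
      · obtain ⟨i, rfl⟩ : ∃ i', i = i' + 4 := ⟨i - 4, by omega⟩
        exact ⟨X 0 ^ (i + 1), 0, 0, 0, 0, 0, by simp, by simp, by simp, by simp, by ring⟩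
      · obtain ⟨i, rfl⟩ : ∃ i', i = i' + 2 := ⟨i - 2, by omega⟩
        exact ⟨0, 0, X 0 ^ i, 0, 0, 0, by simp, by simp, by simp, by simp, by ring⟩
      · refine ⟨0, 0, 0, 0, 0, X 0 ^ i * X 2 ^ l, by simp, by simp, by simp, ?_, by ring⟩
        simp only [map_mul, map_pow, constantCoeff_X, ← pow_add]
        exact zero_pow (by omega)
    · rcases l with _ | l
      · obtain ⟨i, rfl⟩ : ∃ i', i = i' + 2 := ⟨i - 2, by omega⟩
        exact ⟨0, X 0 ^ i, 0, 0, 0, 0, by simp, by simp, by simp, by simp, by ring⟩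
      · refine ⟨0, 0, 0, 0, X 0 ^ i * X 2 ^ l, 0, by simp, by simp, ?_, by simp, by ring⟩
        simp only [map_mul, map_pow, constantCoeff_X, ← pow_add]
        exact zero_pow (by omega)
    · refine ⟨0, 0, 0, X 0 ^ i * X 1 ^ j * X 2 ^ l, 0, 0, by simp, ?_, by simp, by simp, by ring⟩
      simp only [map_mul, map_pow, constantCoeff_X, ← pow_add]
      exact zero_pow (by omega)
  | zero => exact ⟨0, 0, 0, 0, 0, 0, by simp⟩
  | add x y _ _ hx hy =>
    obtain ⟨U, L, M, α, β, γ, h1, h2, h3, h4, rfl⟩ := hx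
    obtain ⟨U', L', M', α', β', γ', h1', h2', h3', h4', rfl⟩ := hy
    exact ⟨U + U', L + L', M + M', α + α', β + β', γ + γ', by simp [h1, h1'], by simp [h2, h2'],
      by simp [h3, h3'], by simp [h4, h4'], by ring⟩
  | smul r x _ hx =>
    obtain ⟨U, L, M, α, β, γ, h1, h2, h3, h4, rfl⟩ := hx
    exact ⟨r * U, r * L, r * M, r * α, r * β, r * γ, by simp [h1], by simp [h2],
      by simp [h3], by simp [h4], by rw [smul_eq_mul]; ring⟩

/-- Replaces the two coefficient conditions by one ideal membership, which an explicit expansion can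
certify. -/
theorem weightedHomogeneousComponent_principal_part {g : MvPolynomial (Fin 3) ℂ} :
    ((∀ m ∈ g.support, 1 ≤ Finsupp.weight a2Weights m) ∧
      weightedHomogeneousComponent a2Weights 1 g = X 0 ^ 3 + X 1 * X 2) ↔
    g - (X 0 ^ 3 + X 1 * X 2) ∈ heavyIdeal := by
  constructor
  · rintro ⟨h1, h2⟩
    rw [mem_heavyIdeal]
    intro m hm
    rw [← h2, mem_support_iff, coeff_sub, coeff_weightedHomogeneousComponent] at hm
    split_ifs at hm with h
    · simp at hm
    · exact lt_of_le_of_ne (h1 m (mem_support_iff.2 (by simpa using hm))) (Ne.symm h)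
  · intro h
    rw [mem_heavyIdeal] at h
    have hw : IsWeightedHomogeneous a2Weights (X 0 ^ 3 + X 1 * X 2 : MvPolynomial (Fin 3) ℂ) 1 := by
      refine IsWeightedHomogeneous.add ?_ ?_
      · have := (isWeightedHomogeneous_X ℂ a2Weights 0).pow 3
        convert this using 1
        norm_num [a2Weights]
      · have := (isWeightedHomogeneous_X ℂ a2Weights 1).mul (isWeightedHomogeneous_X ℂ a2Weights 2)
        convert this using 1
        simp only [a2Weights, Matrix.cons_val_one, Matrix.cons_val]
        norm_num
    constructor
    · intro m hm
      by_cases hm' : m ∈ (g - (X 0 ^ 3 + X 1 * X 2)).support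
      · exact (h m hm').le
      · rw [notMem_support_iff, coeff_sub, sub_eq_zero] at hm'
        rw [mem_support_iff, hm'] at hm
        exact (hw hm).ge
    · ext m
      rw [coeff_weightedHomogeneousComponent]
      split_ifs with hm
      · by_contra hne
        refine absurd (h m ?_) (by rw [hm]; exact lt_irrefl _)
        rw [mem_support_iff, coeff_sub]
        exact sub_ne_zero.2 hne
      · by_contra hne
        exact hm (hw (Ne.symm hne))

theorem analyticAt_eval (p : MvPolynomial (Fin 3) ℂ) (x : Fin 3 → ℂ) :
    AnalyticAt ℂ (fun u => eval u p) x := by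
  have := AnalyticAt.aeval_mvPolynomial (𝕜 := ℂ) (f := fun u : Fin 3 → ℂ => u) (z := x)
    (fun i => (ContinuousLinearMap.proj (R := ℂ) (φ := fun _ : Fin 3 => ℂ) i).analyticAt x) p
  simpa [aeval_eq_eval] using this

/-- Local analytic normal form at a point satisfying the semi-quasihomogeneous criterion. -/
theorem SatisfiesSQHCriterion.exists_local_form {f : MvPolynomial (Fin 4) ℂ}
    {P : Projectivization ℂ (Fin 4 → ℂ)} (h : SatisfiesSQHCriterion f P) :
    ∃ i : Fin 4, P.rep i ≠ 0 ∧ ∃ (Ψ : (Fin 3 → ℂ) → (Fin 3 → ℂ)) (N : (Fin 3 → ℂ) → ℂ),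
      AnalyticAt ℂ Ψ (affineCoord i P) ∧ Ψ (affineCoord i P) = 0 ∧
      Function.Injective (fderiv ℂ Ψ (affineCoord i P)) ∧
      AnalyticAt ℂ N (affineCoord i P) ∧ N (affineCoord i P) ≠ 0 ∧
      ∀ᶠ x in 𝓝 (affineCoord i P), eval (i.insertNth 1 x : Fin 4 → ℂ) f =
        N x * (Ψ x 0 ^ 3 + Ψ x 1 * Ψ x 2) := by
  obtain ⟨i, hi, T, hT, g, hg, h1, h2⟩ := h
  refine ⟨i, hi, ?_⟩
  set p := affineCoord i P
  obtain ⟨U, L, M, α, β, γ, hU, hα, hβ, hγ, hd⟩ := exists_decomposition_of_mem_heavyIdeal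
    (weightedHomogeneousComponent_principal_part.1 ⟨h1, h2⟩)
  -- The summands 1 restore the principal part; the factor 1/2 is there because the normal form
  -- writes the mixed coefficient as 2β.
  obtain ⟨Ψ, N, hΨ, hΨ0, hΨd, hN, hN0, hloc⟩ := exists_a2_local_form
    (U := fun u => eval u (1 + U)) (L := fun u => eval u L) (M := fun u => eval u M)
    (α := fun u => eval u α) (β := fun u => eval u (C (1 / 2) * (1 + β))) (γ := fun u => eval u γ)
    (analyticAt_eval _ _) (analyticAt_eval _ _) (analyticAt_eval _ _) (analyticAt_eval _ _)
    (analyticAt_eval _ _) (analyticAt_eval _ _)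
    (by simp [hU]) (by simp [hα]) (by simp [hβ]) (by simp [hγ])
  have hTd : IsUnit T.det := (Matrix.isUnit_iff_isUnit_det T).1 hT
  let A : (Fin 3 → ℂ) →L[ℂ] (Fin 3 → ℂ) := LinearMap.toContinuousLinearMap T⁻¹.mulVecLin
  have hA : ∀ v, A v = T⁻¹ *ᵥ v := fun v => rfl
  have hAinj : Function.Injective A := by
    intro v w hvw
    rw [hA, hA] at hvw
    have := congrArg (fun z => T *ᵥ z) hvw
    simpa [Matrix.mulVec_mulVec, Matrix.mul_nonsing_inv T hTd] using this
  let G : (Fin 3 → ℂ) → (Fin 3 → ℂ) := fun x => A (x - p)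
  have hGp : G p = 0 := by simp [G]
  have hGan : AnalyticAt ℂ G p := (A.analyticAt _).comp (analyticAt_id.sub analyticAt_const)
  have hGd : HasFDerivAt G A p := by
    exact A.hasFDerivAt.comp p ((hasFDerivAt_id p).sub_const p)
  refine ⟨Ψ ∘ G, N ∘ G, ?_, ?_, ?_, ?_, ?_, ?_⟩
  · exact AnalyticAt.comp (by rwa [hGp]) hGan
  · simp [hGp, hΨ0]
  · have hΨ' : HasFDerivAt Ψ (fderiv ℂ Ψ 0) (G p) := by
      rw [hGp]; exact hΨ.differentiableAt.hasFDerivAt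
    rw [(hΨ'.comp p hGd).fderiv]
    exact hΨd.comp hAinj
  · exact AnalyticAt.comp (by rwa [hGp]) hGan
  · simpa [hGp] using hN0
  · have ht : Tendsto G (𝓝 p) (𝓝 0) := by
      have := hGan.continuousAt.tendsto
      rwa [hGp] at this
    filter_upwards [ht.eventually hloc] with x hx
    have hgx : eval (G x) g = eval (i.insertNth 1 x : Fin 4 → ℂ) f := by
      rw [hg, aeval_def, eval_eval₂]
      have : (eval (G x)).comp (algebraMap ℂ (MvPolynomial (Fin 3) ℂ)) = RingHom.id ℂ := by
        ext; simp
      rw [this, eval₂_id]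
      congr 2
      funext j
      refine Fin.succAboveCases i ?_ (fun j => ?_) j
      · simp
      · have hx' : T *ᵥ G x = x - p := by
          simp only [G, hA]
          rw [Matrix.mulVec_mulVec, Matrix.mul_nonsing_inv T hTd, Matrix.one_mulVec]
        have hxj := congrFun hx' j
        simp only [Matrix.mulVec, dotProduct, Pi.sub_apply] at hxj
        simp only [Fin.insertNth_apply_succAbove, map_add, map_sum, map_mul, eval_C, eval_X]
        rw [hxj]; ring
    simp only [Function.comp_apply]
    rw [← hgx, ← hx, sub_eq_iff_eq_add.1 hd]
    simp only [map_add, map_mul, map_pow, eval_X, map_one, eval_C]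
    ring

theorem SatisfiesSQHCriterion.isA2Cusp {f : MvPolynomial (Fin 4) ℂ}
    {P : Projectivization ℂ (Fin 4 → ℂ)} (h : SatisfiesSQHCriterion f P) :
    IsA2Cusp (r := 0) ![f] P := by
  obtain ⟨i, hi, Ψ, N, hΨ, hΨ0, hinj, hN, hN0, hloc⟩ := h.exists_local_form
  refine isA2Cusp_of_analyticAt i hi rfl Ψ (fun x => Matrix.of fun _ _ => N x) hΨ hΨ0 hinj
    (fun _ _ => hN) ?_ ?_
  · rw [Matrix.isUnit_iff_isUnit_det]
    simpa [Matrix.det_fin_one] using hN0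
  · filter_upwards [hloc] with x hx
    funext j
    fin_cases j
    simpa [Matrix.mulVec, dotProduct, a2Model] using hx

end

/-! ### Expansions of the quartic at the eight points -/

/-- The family of quartic forms `± f_k` with `1 + k` and `1 - k` replaced by independent
parameters. -/
def quarticForm (a b e : ℂ) : MvPolynomial (Fin 4) ℂ :=
  C e * (C a ^ 3 * (X 0 ^ 2 * X 1 ^ 2) + (C a - C b) * C a * C b * (X 0 * X 1 * X 2 * X 3)
    - C b ^ 3 * (X 2 ^ 2 * X 3 ^ 2)
    + C a * C b * (X 0 + X 1 + X 2 + X 3) *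
      (C b * (X 2 * X 3 * (X 0 + X 1)) - C a * (X 0 * X 1 * (X 2 + X 3))))

theorem quartic_eq_quarticForm (k : ℂ) : quartic k = quarticForm (1 + k) (1 - k) 1 := by
  simp only [quartic, quarticForm, map_add, map_sub, map_mul, map_pow, map_one, map_ofNat]
  ring

/-- The semi-quasihomogeneous criterion in terms of a coordinate vector, with the affine
coordinates given by a matrix `L` with a left inverse. -/
def SQHAt (f : MvPolynomial (Fin 4) ℂ) (v : Fin 4 → ℂ) : Prop :=
  ∃ i : Fin 4, v i ≠ 0 ∧ ∃ (L : Matrix (Fin 4) (Fin 3) ℂ) (K : Matrix (Fin 3) (Fin 4) ℂ),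
    (∀ l, L i l = 0) ∧ K * L = 1 ∧
    aeval (fun j => C (v j / v i) + ∑ l, C (L j l) * X l : Fin 4 → MvPolynomial (Fin 3) ℂ) f
      - (X 0 ^ 3 + X 1 * X 2) ∈ heavyIdeal

theorem SQHAt.of_eq {f : MvPolynomial (Fin 4) ℂ} {v : Fin 4 → ℂ} (i : Fin 4) (hi : v i ≠ 0)
    (L : Matrix (Fin 4) (Fin 3) ℂ) (K : Matrix (Fin 3) (Fin 4) ℂ) (g : Fin 4 → MvPolynomial (Fin 3) ℂ)
    (hL : ∀ l, L i l = 0) (hK : K * L = 1) (hg : ∀ j, g j = C (v j / v i) + ∑ l, C (L j l) * X l)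
    (hmem : aeval g f - (X 0 ^ 3 + X 1 * X 2) ∈ heavyIdeal) : SQHAt f v := by
  obtain rfl : g = _ := funext hg
  exact ⟨i, hi, L, K, hL, hK, hmem⟩

theorem rep_mk_div {n : ℕ} (v : Fin n → ℂ) (hv : v ≠ 0) (i j : Fin n) :
    (Projectivization.mk ℂ v hv).rep j / (Projectivization.mk ℂ v hv).rep i = v j / v i := by
  obtain ⟨c, hc⟩ := Projectivization.exists_smul_eq_mk_rep ℂ v hv
  rw [← hc]
  simp only [Units.smul_def, Pi.smul_apply, smul_eq_mul]
  exact mul_div_mul_left _ _ c.ne_zero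

theorem rep_mk_ne_zero_iff {n : ℕ} (v : Fin n → ℂ) (hv : v ≠ 0) (i : Fin n) :
    (Projectivization.mk ℂ v hv).rep i ≠ 0 ↔ v i ≠ 0 := by
  obtain ⟨c, hc⟩ := Projectivization.exists_smul_eq_mk_rep ℂ v hv
  rw [← hc]
  simp [Units.smul_def]

/-- Row i of L vanishes, so deleting it, and column i of K, leaves a square matrix with a left
inverse. Only ratios of coordinates enter, hence the choice of representative is harmless. -/
theorem SQHAt.satisfiesSQHCriterion {f : MvPolynomial (Fin 4) ℂ} {v : Fin 4 → ℂ} (hv : v ≠ 0)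
    (h : SQHAt f v) : SatisfiesSQHCriterion f (Projectivization.mk ℂ v hv) := by
  obtain ⟨i, hi, L, K, hL, hK, hmem⟩ := h
  refine ⟨i, (rep_mk_ne_zero_iff v hv i).2 hi, L.submatrix i.succAbove id, ?_, _, rfl, ?_⟩
  · refine IsUnit.of_mul_eq_one_right (K.submatrix id i.succAbove) ?_
    rw [← hK]
    ext p q
    simp only [Matrix.mul_apply, Matrix.submatrix_apply, id_eq]
    rw [Fin.sum_univ_succAbove _ i, hL, mul_zero, zero_add]
  · rw [weightedHomogeneousComponent_principal_part]
    convert hmem using 4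
    funext j
    refine Fin.succAboveCases i ?_ (fun j => ?_) j
    · simp [hL, div_self hi]
    · simp [affineCoord, rep_mk_div]

theorem SQHAt.rename_perm {f : MvPolynomial (Fin 4) ℂ} {v : Fin 4 → ℂ} (σ : Equiv.Perm (Fin 4))
    (h : SQHAt f (v ∘ σ)) : SQHAt (rename σ f) v := by
  obtain ⟨i, hi, L, K, hL, hK, hmem⟩ := h
  refine ⟨σ i, hi, L.submatrix σ.symm id, K.submatrix id σ.symm, by simpa using hL, ?_, ?_⟩
  · rw [Matrix.submatrix_mul_equiv, hK, Matrix.submatrix_id_id]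
  · rw [aeval_rename]
    convert hmem using 4
    funext j
    simp

/-- These monomials suffice for the remainders of both expansions below. -/
theorem heavyIdeal_combination_mem (r₁ r₂ r₃ r₄ r₅ r₆ r₇ r₈ : MvPolynomial (Fin 3) ℂ) :
    X 0 ^ 4 * r₁ + X 0 ^ 2 * X 1 * r₂ + X 0 ^ 2 * X 2 * r₃ + X 0 * X 1 * X 2 * r₄
      + X 0 * X 1 ^ 2 * r₅ + X 1 ^ 3 * r₆ + X 1 ^ 2 * X 2 * r₇ + X 1 * X 2 ^ 2 * r₈
      ∈ heavyIdeal := by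
  have key : ∀ (i j l : ℕ) (r : MvPolynomial (Fin 3) ℂ), 6 < 2 * i + 3 * j + 3 * l →
      X 0 ^ i * X 1 ^ j * X 2 ^ l * r ∈ heavyIdeal := by
    intro i j l r h
    refine Ideal.mul_mem_right _ _ (Ideal.subset_span ⟨Finsupp.equivFunOnFinite.symm ![i, j, l],
      ?_, ?_⟩)
    · have : (6 : ℚ) < 2 * i + 3 * j + 3 * l := by exact_mod_cast h
      simp only [Set.mem_ofPred_eq, weight_a2Weights, Finsupp.equivFunOnFinite_symm_apply_apply,
        Matrix.cons_val_zero, Matrix.cons_val_one, Matrix.cons_val]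
      linarith
    · simp [monomial_eq_prod_three]
  have h1 := key 4 0 0 r₁ (by norm_num)
  have h2 := key 2 1 0 r₂ (by norm_num)
  have h3 := key 2 0 1 r₃ (by norm_num)
  have h4 := key 1 1 1 r₄ (by norm_num)
  have h5 := key 1 2 0 r₅ (by norm_num)
  have h6 := key 0 3 0 r₆ (by norm_num)
  have h7 := key 0 2 1 r₇ (by norm_num)
  have h8 := key 0 1 2 r₈ (by norm_num)
  simp only [pow_zero, pow_one, mul_one, one_mul] at h1 h2 h3 h4 h5 h6 h7 h8
  exact add_mem (add_mem (add_mem (add_mem (add_mem (add_mem (add_mem h1 h2) h3) h4) h5) h6) h7) h8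

theorem exists_cube_mul_eq_one {c : ℂ} (hc : c ≠ 0) : ∃ t : ℂ, t ≠ 0 ∧ t ^ 3 * c = 1 := by
  obtain ⟨t, ht⟩ := IsAlgClosed.exists_pow_nat_eq c⁻¹ (n := 3) (by norm_num)
  refine ⟨t, ?_, by rw [ht, inv_mul_cancel₀ hc]⟩
  rintro rfl
  exact inv_ne_zero hc (by rw [← ht]; simp)

theorem aeval_quarticForm (a b e : ℂ) (g : Fin 4 → MvPolynomial (Fin 3) ℂ) :
    aeval g (quarticForm a b e) =
      C e * (C a ^ 3 * (g 0 ^ 2 * g 1 ^ 2) + (C a - C b) * C a * C b * (g 0 * g 1 * g 2 * g 3)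
      - C b ^ 3 * (g 2 ^ 2 * g 3 ^ 2)
      + C a * C b * (g 0 + g 1 + g 2 + g 3) *
        (C b * (g 2 * g 3 * (g 0 + g 1)) - C a * (g 0 * g 1 * (g 2 + g 3)))) := by
  simp [quarticForm, algebraMap_eq]

/-- In the chart x₀ = 1 the quadratic part is e·a(ax₁-bx₂)(ax₁-bx₃). The substitution makes the
factors by and bmz, and x runs along their common kernel (b, a, a); t and m normalize the
coefficients of x³ and yz. A general ring allows constants `C a` in a polynomial ring. -/
theorem quarticForm_vertex_expansion {R : Type*} [CommRing R] {a b e t m : R} (x y z : R)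
    {g : Fin 4 → R} (hg : g = ![1, b * t * x, a * t * x - y, a * t * x - m * z])
    (ht : t ^ 3 * (e * (-(a + b) * a ^ 3 * b ^ 2)) = 1) (hm : m * (e * (a * b ^ 2)) = 1) :
    e * (a ^ 3 * (g 0 ^ 2 * g 1 ^ 2) + (a - b) * a * b * (g 0 * g 1 * g 2 * g 3)
      - b ^ 3 * (g 2 ^ 2 * g 3 ^ 2)
      + a * b * (g 0 + g 1 + g 2 + g 3) *
        (b * (g 2 * g 3 * (g 0 + g 1)) - a * (g 0 * g 1 * (g 2 + g 3)))) - (x ^ 3 + y * z) =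
      x ^ 4 * (e * ((a ^ 3 * b ^ 4 * t ^ 4 + a ^ 4 * b ^ 3 * t ^ 4))) +
      x ^ 2 * y * (e * ((a * b ^ 4 * m * t ^ 2) * z + (-a ^ 2 * b ^ 4 * t ^ 3 - 1 * a ^ 3 * b ^ 3 * t ^ 3) * x)) +
      x ^ 2 * z * (e * ((-a ^ 2 * b ^ 4 * m * t ^ 3 - 1 * a ^ 3 * b ^ 3 * m * t ^ 3) * x)) +
      x * y * z * (e * ((a * b ^ 3 * m * t + 3 * a ^ 2 * b ^ 2 * m * t) + (a * b ^ 3 * m ^ 2 * t) * z + (a * b ^ 3 * m * t) * y)) +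
      x * y ^ 2 * (e * (0)) +
      y ^ 3 * (e * (0)) +
      y ^ 2 * z * (e * ((-a * b ^ 2 * m) + (-b ^ 3 * m ^ 2) * z)) +
      y * z ^ 2 * (e * ((-a * b ^ 2 * m ^ 2))) := by
  subst hg
  simp only [Matrix.cons_val_zero, Matrix.cons_val_one, Matrix.cons_val]
  linear_combination x ^ 3 * ht + y * z * hm

/-- With x₁ = p, x₂ = -1+q, x₃ = r the quadratic part is e(ap-br)(a(a+b)p+abq+b(a+b)r). The
substitution makes the factors aby and abmz. -/
theorem quarticForm_diagonal_expansion {R : Type*} [CommRing R] {a b e t m : R} (x y z : R)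
    {g : Fin 4 → R} (hg : g = ![1, b * t * x,
      -1 - 2 * (a + b) * t * x + (a + b) * y + m * z, a * t * x - a * y])
    (ht : t ^ 3 * (e * (-(a + b) ^ 2 * a ^ 2 * b ^ 2)) = 1)
    (hm : m * (e * (a ^ 2 * b ^ 2)) = 1) :
    e * (a ^ 3 * (g 0 ^ 2 * g 1 ^ 2) + (a - b) * a * b * (g 0 * g 1 * g 2 * g 3)
      - b ^ 3 * (g 2 ^ 2 * g 3 ^ 2)
      + a * b * (g 0 + g 1 + g 2 + g 3) *
        (b * (g 2 * g 3 * (g 0 + g 1)) - a * (g 0 * g 1 * (g 2 + g 3)))) - (x ^ 3 + y * z) =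
      x ^ 4 * (e * ((-2 * a ^ 2 * b ^ 5 * t ^ 4 - 4 * a ^ 3 * b ^ 4 * t ^ 4 - 2 * a ^ 4 * b ^ 3 * t ^ 4))) +
      x ^ 2 * y * (e * ((3 * a ^ 2 * b ^ 4 * t ^ 2 + 3 * a ^ 3 * b ^ 3 * t ^ 2) + (-5 * a ^ 2 * b ^ 4 * m * t ^ 2 - 6 * a ^ 3 * b ^ 3 * m * t ^ 2) * z + (-9 * a ^ 2 * b ^ 5 * t ^ 2 - 21 * a ^ 3 * b ^ 4 * t ^ 2 - 12 * a ^ 4 * b ^ 3 * t ^ 2) * y + (7 * a ^ 2 * b ^ 5 * t ^ 3 + 16 * a ^ 3 * b ^ 4 * t ^ 3 + 9 * a ^ 4 * b ^ 3 * t ^ 3) * x)) +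
      x ^ 2 * z * (e * ((a ^ 2 * b ^ 4 * m * t ^ 3 + a ^ 3 * b ^ 3 * m * t ^ 3) * x)) +
      x * y * z * (e * ((a ^ 2 * b ^ 3 * m * t + 3 * a ^ 3 * b ^ 2 * m * t) + (a ^ 2 * b ^ 3 * m ^ 2 * t) * z + (6 * a ^ 2 * b ^ 4 * m * t + 7 * a ^ 3 * b ^ 3 * m * t) * y)) +
      x * y ^ 2 * (e * ((-3 * a ^ 2 * b ^ 4 * t - 3 * a ^ 3 * b ^ 3 * t) + (5 * a ^ 2 * b ^ 5 * t + 11 * a ^ 3 * b ^ 4 * t + 6 * a ^ 4 * b ^ 3 * t) * y)) +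
      y ^ 3 * (e * ((a ^ 2 * b ^ 4 + a ^ 3 * b ^ 3) + (-2 * a ^ 2 * b ^ 4 * m - 2 * a ^ 3 * b ^ 3 * m) * z + (-a ^ 2 * b ^ 5 - 2 * a ^ 3 * b ^ 4 - 1 * a ^ 4 * b ^ 3) * y)) +
      y ^ 2 * z * (e * ((-a ^ 3 * b ^ 2 * m) + (-a ^ 2 * b ^ 3 * m ^ 2) * z)) +
      y * z ^ 2 * (e * ((-a ^ 2 * b ^ 2 * m ^ 2))) := by
  subst hg
  simp only [Matrix.cons_val_zero, Matrix.cons_val_one, Matrix.cons_val]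
  linear_combination x ^ 3 * ht + y * z * hm

theorem sqhAt_quarticForm_vertex {a b e : ℂ} (ha : a ≠ 0) (hb : b ≠ 0) (he : e ≠ 0)
    (hab : a + b ≠ 0) : SQHAt (quarticForm a b e) ![1, 0, 0, 0] := by
  obtain ⟨t, ht0, ht⟩ := exists_cube_mul_eq_one (c := e * (-(a + b) * a ^ 3 * b ^ 2))
    (mul_ne_zero he (mul_ne_zero (mul_ne_zero (neg_ne_zero.2 hab) (pow_ne_zero 3 ha))
      (pow_ne_zero 2 hb)))
  obtain ⟨m, hm⟩ : ∃ m : ℂ, m * (e * (a * b ^ 2)) = 1 :=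
    ⟨(e * (a * b ^ 2))⁻¹, inv_mul_cancel₀ (mul_ne_zero he (mul_ne_zero ha (pow_ne_zero 2 hb)))⟩
  have hm0 : m ≠ 0 := left_ne_zero_of_mul_eq_one hm
  refine SQHAt.of_eq 0 (by simp) !![0, 0, 0; b * t, 0, 0; a * t, -1, 0; a * t, 0, -m]
    !![0, 1 / (b * t), 0, 0; 0, a / b, -1, 0; 0, a / (b * m), 0, -1 / m]
    ![1, C b * C t * X 0, C a * C t * X 0 - X 1, C a * C t * X 0 - C m * X 2] ?_ ?_ ?_ ?_
  · intro l; fin_cases l <;> rfl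
  · ext p q
    fin_cases p <;> fin_cases q <;>
      simp [Matrix.mul_apply, Fin.sum_univ_four] <;> field_simp <;> ring
  · intro j
    fin_cases j <;> simp [Fin.sum_univ_three, sub_eq_add_neg]
  · have ht' := congrArg (C : ℂ → MvPolynomial (Fin 3) ℂ) ht
    have hm' := congrArg (C : ℂ → MvPolynomial (Fin 3) ℂ) hm
    simp only [map_add, map_mul, map_pow, map_one, map_neg] at ht' hm'
    rw [aeval_quarticForm, quarticForm_vertex_expansion (X 0) (X 1) (X 2) rfl ht' hm']
    exact heavyIdeal_combination_mem _ _ _ _ _ _ _ _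

theorem sqhAt_quarticForm_diagonal {a b e : ℂ} (ha : a ≠ 0) (hb : b ≠ 0) (he : e ≠ 0)
    (hab : a + b ≠ 0) : SQHAt (quarticForm a b e) ![1, 0, -1, 0] := by
  obtain ⟨t, ht0, ht⟩ := exists_cube_mul_eq_one (c := e * (-(a + b) ^ 2 * a ^ 2 * b ^ 2))
    (mul_ne_zero he (mul_ne_zero (mul_ne_zero (neg_ne_zero.2 (pow_ne_zero 2 hab))
      (pow_ne_zero 2 ha)) (pow_ne_zero 2 hb)))
  obtain ⟨m, hm⟩ : ∃ m : ℂ, m * (e * (a ^ 2 * b ^ 2)) = 1 :=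
    ⟨(e * (a ^ 2 * b ^ 2))⁻¹,
      inv_mul_cancel₀ (mul_ne_zero he (mul_ne_zero (pow_ne_zero 2 ha) (pow_ne_zero 2 hb)))⟩
  have hm0 : m ≠ 0 := left_ne_zero_of_mul_eq_one hm
  refine SQHAt.of_eq 0 (by simp) !![0, 0, 0; b * t, 0, 0;
      -2 * (a + b) * t, a + b, m; a * t, -a, 0]
    !![0, 1 / (b * t), 0, 0; 0, 1 / b, 0, -1 / a;
      0, (a + b) / (b * m), 1 / m, (a + b) / (a * m)]
    ![1, C b * C t * X 0, -1 - 2 * (C a + C b) * C t * X 0 + (C a + C b) * X 1 + C m * X 2,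
      C a * C t * X 0 - C a * X 1] ?_ ?_ ?_ ?_
  · intro l; fin_cases l <;> rfl
  · ext p q
    fin_cases p <;> fin_cases q <;>
      simp [Matrix.mul_apply, Fin.sum_univ_four] <;> field_simp <;> ring
  · intro j
    fin_cases j <;> simp [Fin.sum_univ_three, show (C 2 : MvPolynomial (Fin 3) ℂ) = 2 from map_ofNat C 2] <;> ring
  · have ht' := congrArg (C : ℂ → MvPolynomial (Fin 3) ℂ) ht
    have hm' := congrArg (C : ℂ → MvPolynomial (Fin 3) ℂ) hm
    simp only [map_add, map_mul, map_pow, map_one, map_neg] at ht' hm'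
    rw [aeval_quarticForm, quarticForm_diagonal_expansion (X 0) (X 1) (X 2) rfl ht' hm']
    exact heavyIdeal_combination_mem _ _ _ _ _ _ _ _

theorem rename_swap_zero_one_quarticForm (a b e : ℂ) :
    rename (Equiv.swap 0 1) (quarticForm a b e) = quarticForm a b e := by
  simp only [quarticForm, map_add, map_sub, map_mul, map_pow, rename_C, rename_X,
    show Equiv.swap (0 : Fin 4) 1 0 = 1 from rfl, show Equiv.swap (0 : Fin 4) 1 1 = 0 from rfl,
    show Equiv.swap (0 : Fin 4) 1 2 = 2 from rfl, show Equiv.swap (0 : Fin 4) 1 3 = 3 from rfl]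
  ring

theorem rename_swap_two_three_quarticForm (a b e : ℂ) :
    rename (Equiv.swap 2 3) (quarticForm a b e) = quarticForm a b e := by
  simp only [quarticForm, map_add, map_sub, map_mul, map_pow, rename_C, rename_X,
    show Equiv.swap (2 : Fin 4) 3 0 = 0 from rfl, show Equiv.swap (2 : Fin 4) 3 1 = 1 from rfl,
    show Equiv.swap (2 : Fin 4) 3 2 = 3 from rfl, show Equiv.swap (2 : Fin 4) 3 3 = 2 from rfl]
  ring

/-- This symmetry exchanges a and b at the cost of a sign, which is why the parameter e is carried
along. -/
theorem rename_swap_pairs_quarticForm (a b e : ℂ) :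
    rename ((Equiv.swap 0 2 * Equiv.swap 1 3 : Equiv.Perm (Fin 4))) (quarticForm b a (-e)) =
      quarticForm a b e := by
  have h : ∀ i : Fin 4, (Equiv.swap 0 2 * Equiv.swap 1 3 : Equiv.Perm (Fin 4)) i = i + 2 := by
    decide
  simp only [quarticForm, map_add, map_sub, map_mul, map_pow, map_neg, rename_C, rename_X, h,
    show (0 + 2 : Fin 4) = 2 from rfl, show (1 + 2 : Fin 4) = 3 from rfl,
    show (2 + 2 : Fin 4) = 0 from rfl, show (3 + 2 : Fin 4) = 1 from rfl]
  ring

/-- The coordinate vectors of the eight singular points of the quartic. -/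
def eightVectors : Set (Fin 4 → ℂ) :=
  {![1, 0, 0, 0], ![0, 1, 0, 0], ![0, 0, 1, 0], ![0, 0, 0, 1],
    ![1, 0, -1, 0], ![1, 0, 0, -1], ![0, 1, -1, 0], ![0, 1, 0, -1]}

/-- The swaps within the pairs {x₀, x₁} and {x₂, x₃}, with the exchange of the pairs, reduce the
vertices to (1:0:0:0) and the other points to (1:0:-1:0). -/
theorem sqhAt_quarticForm {a b : ℂ} (ha : a ≠ 0) (hb : b ≠ 0) (hab : a + b ≠ 0) {v : Fin 4 → ℂ}
    (hv : v ∈ eightVectors) : SQHAt (quarticForm a b 1) v := by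
  have s01 : ∀ v, SQHAt (quarticForm a b 1) (v ∘ Equiv.swap 0 1) → SQHAt (quarticForm a b 1) v :=
    fun v h => rename_swap_zero_one_quarticForm a b 1 ▸ h.rename_perm
  have s23 : ∀ v, SQHAt (quarticForm a b 1) (v ∘ Equiv.swap 2 3) → SQHAt (quarticForm a b 1) v :=
    fun v h => rename_swap_two_three_quarticForm a b 1 ▸ h.rename_perm
  have h0 := sqhAt_quarticForm_vertex ha hb one_ne_zero hab
  have h2 : SQHAt (quarticForm a b 1) ![0, 0, 1, 0] := by
    rw [← rename_swap_pairs_quarticForm]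
    refine SQHAt.rename_perm _ ?_
    convert sqhAt_quarticForm_vertex hb ha (neg_ne_zero.2 one_ne_zero) (by rwa [add_comm]) using 1
    funext j; fin_cases j <;> rfl
  have hd := sqhAt_quarticForm_diagonal ha hb one_ne_zero hab
  have hd' : SQHAt (quarticForm a b 1) ![1, 0, 0, -1] := by
    refine s23 _ ?_
    convert hd using 1
    funext j; fin_cases j <;> rfl
  rcases hv with rfl | rfl | rfl | rfl | rfl | rfl | rfl | rfl
  · exact h0
  · refine s01 _ ?_
    convert h0 using 1
    funext j; fin_cases j <;> rfl
  · exact h2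
  · refine s23 _ ?_
    convert h2 using 1
    funext j; fin_cases j <;> rfl
  · exact hd
  · exact hd'
  · refine s01 _ ?_
    convert hd using 1
    funext j; fin_cases j <;> rfl
  · refine s01 _ ?_
    convert hd' using 1
    funext j; fin_cases j <;> rfl

theorem quartic_sqh_of_mem_eightPoints {k : ℂ} (hk : k ≠ 1) (hk' : k ≠ -1)
    {P : Projectivization ℂ (Fin 4 → ℂ)} (hP : P ∈ eightPoints) :
    SatisfiesSQHCriterion (quartic k) P := by
  obtain ⟨v, hv, hv0, rfl⟩ := hP
  rw [quartic_eq_quarticForm]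
  refine (sqhAt_quarticForm ?_ ?_ ?_ hv).satisfiesSQHCriterion hv0
  · exact fun h => hk' (by linear_combination h)
  · exact fun h => hk (by linear_combination -h)
  · norm_num

/-! ### The cusp of the sextic at the centre -/

section

open Filter Topology Matrix

theorem exists_local_form_quartic_vertex {k : ℂ} (hk : k ≠ 1) (hk' : k ≠ -1) :
    ∃ (Ψ : (Fin 3 → ℂ) → (Fin 3 → ℂ)) (N : (Fin 3 → ℂ) → ℂ),
      AnalyticAt ℂ Ψ 0 ∧ Ψ 0 = 0 ∧ Function.Injective (fderiv ℂ Ψ 0) ∧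
      AnalyticAt ℂ N 0 ∧ N 0 ≠ 0 ∧
      ∀ᶠ x in 𝓝 (0 : Fin 3 → ℂ), eval (![1, x 0, x 1, x 2] : Fin 4 → ℂ) (quartic k) =
        N x * (Ψ x 0 ^ 3 + Ψ x 1 * Ψ x 2) := by
  have hv : (![1, 0, 0, 0] : Fin 4 → ℂ) ≠ 0 := fun h => by simpa using congrFun h 0
  obtain ⟨i, hi, Ψ, N, h⟩ := (quartic_sqh_of_mem_eightPoints hk hk'
    (P := Projectivization.mk ℂ _ hv) ⟨_, Or.inl rfl, hv, rfl⟩).exists_local_form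
  rw [rep_mk_ne_zero_iff] at hi
  obtain rfl : i = 0 := by
    fin_cases i <;> simp at hi
    rfl
  have h0 : affineCoord 0 (Projectivization.mk ℂ _ hv) = 0 := by
    funext j
    rw [affineCoord, rep_mk_div]
    fin_cases j <;> simp
  rw [h0] at h
  refine ⟨Ψ, N, h.1, h.2.1, h.2.2.1, h.2.2.2.1, h.2.2.2.2.1, ?_⟩
  filter_upwards [h.2.2.2.2.2] with x hx
  rw [← hx]
  congr 2
  funext j
  fin_cases j <;> rfl

/-- Elimination of the sixth equation of the sextic: modulo the hyperplane and the quadric, a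
multiple of the cubic is the quartic. -/
theorem eval_sexticForms_chart (k : ℂ) (w : Fin 5 → ℂ) :
    ((1 + k) * (1 + w 1) - (1 - k) * (w 3 + w 4)) *
        eval (Fin.insertNth 0 1 w : Fin 6 → ℂ) (sexticForms k 2) =
      ((1 + k) ^ 2 * w 1 - (1 - k) ^ 2 * (w 3 * w 4)) *
        eval (Fin.insertNth 0 1 w : Fin 6 → ℂ) (sexticForms k 1) +
      (1 - k) * ((1 - k) * (w 3 * w 4) * ((1 + k) * (1 + w 1) - (1 - k) * (w 3 + w 4)) -
        (w 3 + w 4) * ((1 + k) ^ 2 * w 1 - (1 - k) ^ 2 * (w 3 * w 4))) *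
        eval (Fin.insertNth 0 1 w : Fin 6 → ℂ) (sexticForms k 0)
      - eval (![1, w 1, w 3, w 4] : Fin 4 → ℂ) (quartic k) := by
  have e : (Fin.insertNth 0 1 w : Fin 6 → ℂ) = ![1, w 0, w 1, w 2, w 3, w 4] := by
    funext j; fin_cases j <;> rfl
  rw [e]
  simp [sexticForms, quartic]
  ring

theorem affineCoord_centre : affineCoord 0 centre = ![0, 0, -1, 0, 0] := by
  funext j
  rw [affineCoord, centre, rep_mk_div]
  fin_cases j <;> simp [centreVec, Fin.succAbove]

/-- Near c the sextic is compared with the quartic through (x₁:x₃:x₅:x₆), the projection from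
(0:1:0:-1:0:0), which sends c to a vertex. In `eval_sexticForms_chart` the cubic has coefficient A,
and A = 1+k ≠ 0 at c, so it can be traded for the quartic. -/
theorem isA2Cusp_centre {k : ℂ} (hk : k ≠ 1) (hk' : k ≠ -1) :
    IsA2Cusp (r := 2) (sexticForms k) centre := by
  obtain ⟨Ψ, N, hΨ, hΨ0, hinj, hN, hN0, hloc⟩ := exists_local_form_quartic_vertex hk hk'
  have ha : 1 + k ≠ 0 := fun h => hk' (by linear_combination h)
  let p : Fin 5 → ℂ := ![0, 0, -1, 0, 0]
  let Y : (Fin 5 → ℂ) →L[ℂ] (Fin 3 → ℂ) := ContinuousLinearMap.pi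
    ![ContinuousLinearMap.proj 1, ContinuousLinearMap.proj 3, ContinuousLinearMap.proj 4]
  have hY0 : ∀ w, Y w 0 = w 1 := fun w => rfl
  have hY1 : ∀ w, Y w 1 = w 3 := fun w => rfl
  have hY2 : ∀ w, Y w 2 = w 4 := fun w => rfl
  have hYp : Y p = 0 := by
    funext j; fin_cases j <;> simp [hY0, hY1, hY2, p]
  let l : (Fin 5 → ℂ) → ℂ := fun w => 1 + w 0 + w 1 + w 2 + w 3 + w 4
  let q : (Fin 5 → ℂ) → ℂ := fun w => (1 + k) * (w 0 + w 1 + w 0 * w 1)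
    + (1 - k) * (w 2 * w 3 + w 2 * w 4 + w 3 * w 4)
  let A : (Fin 5 → ℂ) → ℂ := fun w => (1 + k) * (1 + w 1) - (1 - k) * (w 3 + w 4)
  let B : (Fin 5 → ℂ) → ℂ := fun w => (1 + k) ^ 2 * w 1 - (1 - k) ^ 2 * (w 3 * w 4)
  let H : (Fin 5 → ℂ) → ℂ := fun w =>
    (1 - k) * ((1 - k) * (w 3 * w 4) * A w - (w 3 + w 4) * B w)
  have hw : ∀ i : Fin 5, AnalyticAt ℂ (fun w : Fin 5 → ℂ => w i) p := fun i =>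
    (ContinuousLinearMap.proj (R := ℂ) (φ := fun _ : Fin 5 => ℂ) i).analyticAt p
  have cst : ∀ c : ℂ, AnalyticAt ℂ (fun _ : Fin 5 → ℂ => c) p := fun c => analyticAt_const
  have hA : AnalyticAt ℂ A p := ((cst _).mul ((cst _).add (hw 1))).sub
    ((cst _).mul ((hw 3).add (hw 4)))
  have hB : AnalyticAt ℂ B p := ((cst _).mul (hw 1)).sub ((cst _).mul ((hw 3).mul (hw 4)))
  have hH : AnalyticAt ℂ H p := (cst _).mul ((((cst _).mul ((hw 3).mul (hw 4))).mul hA).sub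
    (((hw 3).add (hw 4)).mul hB))
  have hl : AnalyticAt ℂ l p :=
    (((((cst _).add (hw 0)).add (hw 1)).add (hw 2)).add (hw 3)).add (hw 4)
  have hq : AnalyticAt ℂ q p :=
    ((cst _).mul (((hw 0).add (hw 1)).add ((hw 0).mul (hw 1)))).add
      ((cst _).mul ((((hw 2).mul (hw 3)).add ((hw 2).mul (hw 4))).add ((hw 3).mul (hw 4))))
  have hAp : A p ≠ 0 := by simpa [A, p] using ha
  have hYan : AnalyticAt ℂ Y p := Y.analyticAt p
  have hΨY : AnalyticAt ℂ (fun w => Ψ (Y w)) p := AnalyticAt.fun_comp (by rwa [hYp]) hYan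
  have hNY : AnalyticAt ℂ (fun w => N (Y w)) p := AnalyticAt.fun_comp (by rwa [hYp]) hYan
  -- The cusp coordinates of the quartic, completed by the hyperplane and the quadric as transverse
  -- coordinates.
  let Φ : (Fin 5 → ℂ) → (Fin 5 → ℂ) := fun w =>
    ![Ψ (Y w) 0, Ψ (Y w) 1, Ψ (Y w) 2, l w, q w]
  have hΦi : ∀ i, AnalyticAt ℂ (fun w => Φ w i) p := by
    have h3 : ∀ i, AnalyticAt ℂ (fun w => Ψ (Y w) i) p := analyticAt_pi_iff.1 hΨY
    intro i
    fin_cases i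
    · exact h3 0
    · exact h3 1
    · exact h3 2
    · exact hl
    · exact hq
  have hΦ : AnalyticAt ℂ Φ p := analyticAt_pi_iff.2 hΦi
  refine isA2Cusp_of_analyticAt (r := 2) (p := p) 0 ?_ affineCoord_centre Φ
    (fun w => !![0, 1, 0; 0, 0, 1; -N (Y w) / A w, H w / A w, B w / A w]) hΦ ?_ ?_ ?_ ?_ ?_
  · rw [centre, rep_mk_ne_zero_iff]
    simp [centreVec]
  · funext i
    fin_cases i <;> simp [Φ, hYp, hΨ0, l, q, p]
  · rw [injective_iff_map_eq_zero]
    intro v hv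
    have hcomp : ∀ i, fderiv ℂ (fun w => Φ w i) p v = 0 := by
      intro i
      have h1 := (hasFDerivAt_pi'.1 hΦ.differentiableAt.hasFDerivAt i).fderiv
      rw [h1]
      exact congrFun hv i
    have hΨd : fderiv ℂ Ψ 0 (Y v) = 0 := by
      have h1 : HasFDerivAt (fun w => Ψ (Y w)) ((fderiv ℂ Ψ 0).comp Y) p := by
        have : HasFDerivAt Ψ (fderiv ℂ Ψ 0) (Y p) := by
          rw [hYp]; exact hΨ.differentiableAt.hasFDerivAt
        exact this.comp p Y.hasFDerivAt
      funext i
      have h2 := (hasFDerivAt_pi'.1 h1 i).fderiv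
      have h3 : fderiv ℂ (fun w => Ψ (Y w) i) p v = 0 := by
        fin_cases i
        · exact hcomp 0
        · exact hcomp 1
        · exact hcomp 2
      rw [h2] at h3
      exact h3
    -- The derivative of Φ is triangular: Ψ ∘ Y kills v₁, v₃, v₄, then the quadric kills v₀
    -- (coefficient 1+k), then the hyperplane kills v₂.
    have hYv : Y v = 0 := (injective_iff_map_eq_zero _).1 hinj _ hΨd
    have hv1 : v 1 = 0 := congrFun hYv 0
    have hv3 : v 3 = 0 := congrFun hYv 1
    have hv4 : v 4 = 0 := congrFun hYv 2
    have hc : ∀ i : Fin 5, HasFDerivAt (fun w : Fin 5 → ℂ => w i)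
      (ContinuousLinearMap.proj (R := ℂ) (φ := fun _ : Fin 5 => ℂ) i) p := fun i =>
        hasFDerivAt_apply i p
    have hq' : HasFDerivAt q _ p := ((((hc 0).add (hc 1)).add ((hc 0).mul (hc 1))).const_mul (1 + k)).add
      (((((hc 2).mul (hc 3)).add ((hc 2).mul (hc 4))).add ((hc 3).mul (hc 4))).const_mul (1 - k))
    have hqv : fderiv ℂ q p v = 0 := hcomp 4
    rw [hq'.fderiv] at hqv
    have hv0 : v 0 = 0 := by
      simpa [hv1, hv3, hv4, p, ha] using hqv
    have hl' : HasFDerivAt l _ p := (((((hc 0).const_add 1).add (hc 1)).add (hc 2)).add (hc 3)).add (hc 4)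
    have hlv : fderiv ℂ l p v = 0 := hcomp 3
    rw [hl'.fderiv] at hlv
    have hv2 : v 2 = 0 := by
      simpa [hv0, hv1, hv3, hv4] using hlv
    funext i
    fin_cases i
    · exact hv0
    · exact hv1
    · exact hv2
    · exact hv3
    · exact hv4
  · intro i j
    fin_cases i <;> fin_cases j
    · exact analyticAt_const
    · exact analyticAt_const
    · exact analyticAt_const
    · exact analyticAt_const
    · exact analyticAt_const
    · exact analyticAt_const
    · exact hNY.neg.div hA hAp
    · exact hH.div hA hAp
    · exact hB.div hA hAp
  · rw [Matrix.isUnit_iff_isUnit_det, isUnit_iff_ne_zero]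
    simpa [Matrix.det_fin_three, hYp] using ⟨hN0, hAp⟩
  · have ht : Tendsto Y (𝓝 p) (𝓝 0) := by
      have := Y.continuous.tendsto p
      rwa [hYp] at this
    filter_upwards [ht.eventually hloc, hA.continuousAt.eventually_ne hAp] with w hw1 hw2
    have e : (Fin.insertNth 0 1 w : Fin 6 → ℂ) = ![1, w 0, w 1, w 2, w 3, w 4] := by
      funext j; fin_cases j <;> rfl
    have e0 : eval (Fin.insertNth 0 1 w : Fin 6 → ℂ) (sexticForms k 0) = l w := by
      rw [e]; simp [sexticForms, l]
    have e1 : eval (Fin.insertNth 0 1 w : Fin 6 → ℂ) (sexticForms k 1) = q w := by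
      rw [e]; simp [sexticForms, q]
    have e2 := eval_sexticForms_chart k w
    rw [e0, e1] at e2
    rw [hY0, hY1, hY2] at hw1
    rw [hw1] at e2
    have hm : a2Model (r := 2) (Φ w) =
        ![Ψ (Y w) 0 ^ 3 + Ψ (Y w) 1 * Ψ (Y w) 2, l w, q w] := by
      funext j; fin_cases j <;> rfl
    rw [hm]
    funext j
    fin_cases j
    · simpa [Matrix.mulVec, dotProduct, Fin.sum_univ_three] using e0
    · simpa [Matrix.mulVec, dotProduct, Fin.sum_univ_three] using e1
    · have : eval (Fin.insertNth 0 1 w : Fin 6 → ℂ) (sexticForms k 2) =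
          -N (Y w) / A w * (Ψ (Y w) 0 ^ 3 + Ψ (Y w) 1 * Ψ (Y w) 2) + H w / A w * l w
            + B w / A w * q w := by
        field_simp
        linear_combination e2
      simpa [Matrix.mulVec, dotProduct, Fin.sum_univ_three] using this

end

/-! ### The singular locus of the quartic -/

theorem eval_quartic (k : ℂ) (x : Fin 4 → ℂ) : eval x (quartic k) =
    (1 + k) ^ 3 * (x 0 ^ 2 * x 1 ^ 2) + 2 * k * (1 - k ^ 2) * (x 0 * x 1 * x 2 * x 3)
    - (1 - k) ^ 3 * (x 2 ^ 2 * x 3 ^ 2)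
    + (1 - k ^ 2) * (x 0 + x 1 + x 2 + x 3) *
      ((1 - k) * (x 2 * x 3 * (x 0 + x 1)) - (1 + k) * (x 0 * x 1 * (x 2 + x 3))) := by
  simp [quartic]

/-- The gradient of the quartic, as a polynomial in the symmetric functions of `x₀, x₁` and
of `x₂, x₃`. -/
theorem eval_pderiv_quartic (k : ℂ) (x : Fin 4 → ℂ) (a b E s F G : ℂ)
    (ha : a = 1 + k) (hb : b = 1 - k) (hs : s = x 0 + x 1 + x 2 + x 3)
    (hE : E = b * (x 0 + x 1) * (x 2 * x 3) - a * (x 2 + x 3) * (x 0 * x 1))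
    (hF : F = 2 * a ^ 3 * (x 0 * x 1) + (a - b) * a * b * (x 2 * x 3)
      - a ^ 2 * b * s * (x 2 + x 3))
    (hG : G = (a - b) * a * b * (x 0 * x 1) - 2 * b ^ 3 * (x 2 * x 3)
      + a * b ^ 2 * s * (x 0 + x 1)) :
    eval x (pderiv 0 (quartic k)) = a * b * E + a * b ^ 2 * s * (x 2 * x 3) + x 1 * F ∧
    eval x (pderiv 1 (quartic k)) = a * b * E + a * b ^ 2 * s * (x 2 * x 3) + x 0 * F ∧
    eval x (pderiv 2 (quartic k)) = a * b * E - a ^ 2 * b * s * (x 0 * x 1) + x 3 * G ∧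
    eval x (pderiv 3 (quartic k)) = a * b * E - a ^ 2 * b * s * (x 0 * x 1) + x 2 * G := by
  subst ha hb hs hE hF hG
  refine ⟨?_, ?_, ?_, ?_⟩ <;>
    simp [quartic, pderiv_X] <;> ring

/-- The binary quartic cut out by the line `x₀ = x₁`, `x₂ = x₃` has no multiple root. -/
theorem binary_quartic_nonsingular {a b U V : ℂ} (ha : a ≠ 0) (hb : b ≠ 0) (hab : a + b ≠ 0)
    (h1 : (b * U ^ 3 - 3 * b * U ^ 2 * V - 3 * a * U * V ^ 2 + a * V ^ 3)
      + (U - V) * (3 * b * U ^ 2 - 6 * b * U * V - 3 * a * V ^ 2) = 0)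
    (h2 : -(b * U ^ 3 - 3 * b * U ^ 2 * V - 3 * a * U * V ^ 2 + a * V ^ 3)
      + (U - V) * (-3 * b * U ^ 2 - 6 * a * U * V + 3 * a * V ^ 2) = 0) :
    U = 0 ∧ V = 0 := by
  -- Euler's relation: the hypotheses are the two partial derivatives of this binary quartic.
  have h3 : (U - V) * (b * U ^ 3 - 3 * b * U ^ 2 * V - 3 * a * U * V ^ 2 + a * V ^ 3) = 0 := by
    linear_combination (U * h1 + V * h2) / 4
  by_cases hUV : U - V = 0
  · obtain rfl : U = V := sub_eq_zero.1 hUV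
    have : (a + b) * U ^ 3 = 0 := by linear_combination -h1 / 2
    have : U = 0 := by simpa [hab] using this
    exact ⟨this, this⟩
  · have hc := (mul_eq_zero.1 h3).resolve_left hUV
    rw [hc] at h1 h2
    have h4 : 3 * b * U ^ 2 - 6 * b * U * V - 3 * a * V ^ 2 = 0 := by simpa [hUV] using h1
    have h5 : -3 * b * U ^ 2 - 6 * a * U * V + 3 * a * V ^ 2 = 0 := by
      refine (mul_eq_zero.1 ?_).resolve_left hUV
      linear_combination h2
    have h6 : (a + b) * (U * V) = 0 := by linear_combination -(h4 + h5) / 6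
    rcases mul_eq_zero.1 ((mul_eq_zero.1 h6).resolve_left hab) with rfl | rfl
    · exact ⟨rfl, by simpa [ha] using h4⟩
    · exact ⟨by simpa [hb] using h4, rfl⟩

theorem gradient_eq_zero_imp {a b x₀ x₁ x₂ x₃ E s F G : ℂ} (ha : a ≠ 0) (hb : b ≠ 0)
    (hab : a + b ≠ 0) (hs : s = x₀ + x₁ + x₂ + x₃)
    (hE : E = b * (x₀ + x₁) * (x₂ * x₃) - a * (x₂ + x₃) * (x₀ * x₁))
    (hF : F = 2 * a ^ 3 * (x₀ * x₁) + (a - b) * a * b * (x₂ * x₃) - a ^ 2 * b * s * (x₂ + x₃))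
    (hG : G = (a - b) * a * b * (x₀ * x₁) - 2 * b ^ 3 * (x₂ * x₃) + a * b ^ 2 * s * (x₀ + x₁))
    (h0 : a * b * E + a * b ^ 2 * s * (x₂ * x₃) + x₁ * F = 0)
    (h1 : a * b * E + a * b ^ 2 * s * (x₂ * x₃) + x₀ * F = 0)
    (h2 : a * b * E - a ^ 2 * b * s * (x₀ * x₁) + x₃ * G = 0)
    (h3 : a * b * E - a ^ 2 * b * s * (x₀ * x₁) + x₂ * G = 0) :
    x₀ * x₁ = 0 ∧ x₂ * x₃ = 0 ∧ s * (x₀ + x₁) * (x₂ + x₃) = 0 := by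
  have hF' : (x₀ - x₁) * F = 0 := by linear_combination h1 - h0
  have hG' : (x₂ - x₃) * G = 0 := by linear_combination h3 - h2
  have hABne : a * b ≠ 0 := mul_ne_zero ha hb
  rcases mul_eq_zero.1 hF' with e1 | F0 <;> rcases mul_eq_zero.1 hG' with e2 | G0
  · obtain rfl : x₀ = x₁ := sub_eq_zero.1 e1
    obtain rfl : x₂ = x₃ := sub_eq_zero.1 e2
    -- Rescaling by a and b makes U-V a factor of the restricted quartic.
    obtain ⟨hU, hV⟩ := binary_quartic_nonsingular (U := a * x₀) (V := b * x₂) ha hb hab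
      (by rw [hE, hF, hs] at h0; linear_combination 2 * b * h0)
      (by rw [hE, hG, hs] at h2; linear_combination 2 * a * h2)
    have u0 : x₀ = 0 := by simpa [ha] using hU
    have v0 : x₂ = 0 := by simpa [hb] using hV
    simp [u0, v0]
  · obtain rfl : x₀ = x₁ := sub_eq_zero.1 e1
    rw [G0] at h2
    by_cases u0 : x₀ = 0
    · subst u0
      have : x₂ * x₃ = 0 := by
        have : b ^ 3 * (x₂ * x₃) = 0 := by linear_combination (G0 - hG) / (-2)
        simpa [hb] using this
      simp [this]
    · exfalso
      -- Substituting this relation into G = 0 leaves ab(a+b)x₀² = 0.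
      have h4 : b * (x₂ * x₃) = a * x₀ * (x₂ + x₃ + x₀) := by
        have : (2 * a * b * x₀) * (b * (x₂ * x₃) - a * x₀ * (x₂ + x₃ + x₀)) = 0 := by
          rw [hE, hs] at h2; linear_combination h2
        have := (mul_eq_zero.1 this).resolve_left (by simp [ha, hb, u0])
        linear_combination this
      have : a * b * (a + b) * x₀ ^ 2 = 0 := by
        rw [hs] at hG
        linear_combination G0 - hG + 2 * b ^ 2 * h4
      simp [ha, hb, hab, u0] at this
  · obtain rfl : x₂ = x₃ := sub_eq_zero.1 e2
    rw [F0] at h0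
    by_cases v0 : x₂ = 0
    · subst v0
      have : x₀ * x₁ = 0 := by
        have : a ^ 3 * (x₀ * x₁) = 0 := by linear_combination (F0 - hF) / 2
        simpa [ha] using this
      simp [this]
    · exfalso
      have h4 : a * (x₀ * x₁) = b * x₂ * (x₀ + x₁ + x₂) := by
        have : (2 * a * b * x₂) * (b * x₂ * (x₀ + x₁ + x₂) - a * (x₀ * x₁)) = 0 := by
          rw [hE, hs] at h0; linear_combination h0
        have := (mul_eq_zero.1 this).resolve_left (by simp [ha, hb, v0])
        linear_combination -this
      have : a * b * (a + b) * x₂ ^ 2 = 0 := by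
        rw [hs] at hF
        linear_combination hF - F0 + 2 * a ^ 2 * h4
      simp [ha, hb, hab, v0] at this
  · rw [F0] at h0
    rw [G0] at h2
    have k0 : E + b * s * (x₂ * x₃) = 0 := by
      refine (mul_eq_zero.1 (?_ : a * b * _ = 0)).resolve_left hABne
      linear_combination h0
    have k1 : E - a * s * (x₀ * x₁) = 0 := by
      refine (mul_eq_zero.1 (?_ : a * b * _ = 0)).resolve_left hABne
      linear_combination h2
    have k2 : s * (a * (x₀ * x₁) + b * (x₂ * x₃)) = 0 := by linear_combination k0 - k1
    have kF : 2 * a ^ 2 * (x₀ * x₁) + (a - b) * b * (x₂ * x₃) - a * b * s * (x₂ + x₃) = 0 := by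
      refine (mul_eq_zero.1 (?_ : a * _ = 0)).resolve_left ha
      linear_combination F0 - hF
    have kG : (a - b) * a * (x₀ * x₁) - 2 * b ^ 2 * (x₂ * x₃) + a * b * s * (x₀ + x₁) = 0 := by
      refine (mul_eq_zero.1 (?_ : b * _ = 0)).resolve_left hb
      linear_combination G0 - hG
    rcases mul_eq_zero.1 k2 with s0 | k3
    -- For s = 0 this is a linear system in x₀x₁ and x₂x₃ with determinant -ab(a+b)².
    · rw [s0] at kF kG
      have e3 : a * (a + b) ^ 2 * (x₀ * x₁) = 0 := by
        linear_combination 2 * b * kF + (a - b) * kG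
      have e4 : b * (a + b) ^ 2 * (x₂ * x₃) = 0 := by
        linear_combination (a - b) * kF - 2 * a * kG
      refine ⟨?_, ?_, by rw [s0]; ring⟩
      · exact (mul_eq_zero.1 e3).resolve_left (mul_ne_zero ha (pow_ne_zero 2 hab))
      · exact (mul_eq_zero.1 e4).resolve_left (mul_ne_zero hb (pow_ne_zero 2 hab))
    · have e5 : (a + b) * (x₂ * x₃) + a * s * (x₂ + x₃) = 0 := by
        refine (mul_eq_zero.1 (?_ : b * _ = 0)).resolve_left hb
        linear_combination -kF + 2 * a * k3
      have e6 : -((a + b) * (x₂ * x₃)) + a * s * (x₀ + x₁) = 0 := by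
        refine (mul_eq_zero.1 (?_ : b * _ = 0)).resolve_left hb
        linear_combination kG - (a - b) * k3
      have e7 : a * s ^ 2 = 0 := by linear_combination e5 + e6 + a * s * hs
      have s0 : s = 0 := by simpa [ha] using e7
      rw [s0] at e5
      have e8 : x₂ * x₃ = 0 := by simpa [hab] using e5
      rw [e8] at k3
      exact ⟨by simpa [ha] using k3, e8, by rw [s0]; ring⟩

/-- The first two equations give four lines, such as x₀ = x₂ = 0; on each the third leaves two
vertices and one point with opposite coordinates. Each vertex lies on two of the lines. -/
theorem mk_mem_eightPoints_iff {v : Fin 4 → ℂ} (hv : v ≠ 0) :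
    Projectivization.mk ℂ v hv ∈ eightPoints ↔ v 0 * v 1 = 0 ∧ v 2 * v 3 = 0 ∧
      (v 0 + v 1 + v 2 + v 3) * (v 0 + v 1) * (v 2 + v 3) = 0 := by
  constructor
  · rintro ⟨w, hw, hw0, h⟩
    obtain ⟨c, rfl⟩ := (Projectivization.mk_eq_mk_iff' ℂ _ _ _ _).1 h
    rcases hw with rfl | rfl | rfl | rfl | rfl | rfl | rfl | rfl <;> simp
  · rintro ⟨h1, h2, h3⟩
    have key : ∀ w : Fin 4 → ℂ, w ∈ eightVectors → ∀ c : ℂ, c • w = v →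
        Projectivization.mk ℂ v hv ∈ eightPoints := by
      intro w hw c hc
      have hw0 : w ≠ 0 := by
        rintro rfl
        exact hv (by rw [← hc, smul_zero])
      exact ⟨w, hw, hw0, (Projectivization.mk_eq_mk_iff' ℂ _ _ _ _).2 ⟨c, hc⟩⟩
    have ext4 : ∀ x y : Fin 4 → ℂ, x 0 = y 0 → x 1 = y 1 → x 2 = y 2 → x 3 = y 3 → x = y := by
      intro x y h0 h1 h2 h3
      funext j
      fin_cases j
      · exact h0
      · exact h1
      · exact h2
      · exact h3
    rcases mul_eq_zero.1 h1 with h1 | h1 <;> rcases mul_eq_zero.1 h2 with h2 | h2 <;>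
      simp only [h1, h2, zero_add, add_zero, mul_eq_zero] at h3 <;>
      rcases h3 with (h3 | h3) | h3
    · exact key ![0, 1, 0, -1] (by simp [eightVectors]) (v 1)
        (ext4 _ _ (by simp [h1]) (by simp) (by simp [h2]) (by simp; linear_combination -h3))
    · exact key ![0, 0, 0, 1] (by simp [eightVectors]) (v 3)
        (ext4 _ _ (by simp [h1]) (by simp [h3]) (by simp [h2]) (by simp))
    · exact key ![0, 1, 0, 0] (by simp [eightVectors]) (v 1)
        (ext4 _ _ (by simp [h1]) (by simp) (by simp [h2]) (by simp [h3]))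
    · exact key ![0, 1, -1, 0] (by simp [eightVectors]) (v 1)
        (ext4 _ _ (by simp [h1]) (by simp) (by simp; linear_combination -h3) (by simp [h2]))
    · exact key ![0, 0, 1, 0] (by simp [eightVectors]) (v 2)
        (ext4 _ _ (by simp [h1]) (by simp [h3]) (by simp) (by simp [h2]))
    · exact key ![0, 1, 0, 0] (by simp [eightVectors]) (v 1)
        (ext4 _ _ (by simp [h1]) (by simp) (by simp [h3]) (by simp [h2]))
    · exact key ![1, 0, 0, -1] (by simp [eightVectors]) (v 0)
        (ext4 _ _ (by simp) (by simp [h1]) (by simp [h2]) (by simp; linear_combination -h3))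
    · exact key ![0, 0, 0, 1] (by simp [eightVectors]) (v 3)
        (ext4 _ _ (by simp [h3]) (by simp [h1]) (by simp [h2]) (by simp))
    · exact key ![1, 0, 0, 0] (by simp [eightVectors]) (v 0)
        (ext4 _ _ (by simp) (by simp [h1]) (by simp [h2]) (by simp [h3]))
    · exact key ![1, 0, -1, 0] (by simp [eightVectors]) (v 0)
        (ext4 _ _ (by simp) (by simp [h1]) (by simp; linear_combination -h3) (by simp [h2]))
    · exact key ![0, 0, 1, 0] (by simp [eightVectors]) (v 2)
        (ext4 _ _ (by simp [h3]) (by simp [h1]) (by simp) (by simp [h2]))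
    · exact key ![1, 0, 0, 0] (by simp [eightVectors]) (v 0)
        (ext4 _ _ (by simp) (by simp [h1]) (by simp [h3]) (by simp [h2]))

theorem singularPoints_quartic {k : ℂ} (hk : k ≠ 1) (hk' : k ≠ -1) :
    singularPoints (quartic k) = eightPoints := by
  have ha : 1 + k ≠ 0 := fun h => hk' (by linear_combination h)
  have hb : 1 - k ≠ 0 := fun h => hk (by linear_combination -h)
  ext P
  rw [← P.mk_rep, mk_mem_eightPoints_iff, P.mk_rep, singularPoints, Set.mem_ofPred_eq]
  generalize P.rep = x
  obtain ⟨d0, d1, d2, d3⟩ := eval_pderiv_quartic k x _ _ _ _ _ _ rfl rfl rfl rfl rfl rfl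
  constructor
  · rintro ⟨-, h⟩
    exact gradient_eq_zero_imp ha hb (by norm_num) rfl rfl rfl rfl
      (d0.symm.trans (h 0)) (d1.symm.trans (h 1)) (d2.symm.trans (h 2)) (d3.symm.trans (h 3))
  · rintro ⟨h1, h2, h3⟩
    rw [h1, h2] at d0 d1 d2 d3
    have k0 : (x 0 + x 1 + x 2 + x 3) * (x 2 + x 3) * x 1 = 0 := by
      rcases mul_eq_zero.1 h1 with h | h
      · linear_combination h3 - (x 0 + x 1 + x 2 + x 3) * (x 2 + x 3) * h
      · rw [h, mul_zero]
    have k1 : (x 0 + x 1 + x 2 + x 3) * (x 2 + x 3) * x 0 = 0 := by linear_combination h3 - k0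
    have k2 : (x 0 + x 1 + x 2 + x 3) * (x 0 + x 1) * x 3 = 0 := by
      rcases mul_eq_zero.1 h2 with h | h
      · linear_combination h3 - (x 0 + x 1 + x 2 + x 3) * (x 0 + x 1) * h
      · rw [h, mul_zero]
    have k3 : (x 0 + x 1 + x 2 + x 3) * (x 0 + x 1) * x 2 = 0 := by linear_combination h3 - k2
    refine ⟨?_, fun i => ?_⟩
    · rw [eval_quartic]
      linear_combination ((1 + k) ^ 3 * (x 0 * x 1) + 2 * k * (1 - k ^ 2) * (x 2 * x 3)
        - (1 - k ^ 2) * (x 0 + x 1 + x 2 + x 3) * (1 + k) * (x 2 + x 3)) * h1 +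
        (-(1 - k) ^ 3 * (x 2 * x 3)
          + (1 - k ^ 2) * (x 0 + x 1 + x 2 + x 3) * (1 - k) * (x 0 + x 1)) * h2
    · fin_cases i
      · exact d0.trans (by linear_combination -(1 + k) ^ 2 * (1 - k) * k0)
      · exact d1.trans (by linear_combination -(1 + k) ^ 2 * (1 - k) * k1)
      · exact d2.trans (by linear_combination (1 + k) * (1 - k) ^ 2 * k2)
      · exact d3.trans (by linear_combination (1 + k) * (1 - k) ^ 2 * k3)

theorem ncard_eightPoints : eightPoints.ncard = 8 := by
  let w : Fin 8 → Fin 4 → ℂ := ![![1, 0, 0, 0], ![0, 1, 0, 0], ![0, 0, 1, 0], ![0, 0, 0, 1],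
    ![1, 0, -1, 0], ![1, 0, 0, -1], ![0, 1, -1, 0], ![0, 1, 0, -1]]
  have hw : ∀ i, w i ≠ 0 := by
    intro i h
    have h0 := congrFun h 0
    have h1 := congrFun h 1
    have h2 := congrFun h 2
    have h3 := congrFun h 3
    fin_cases i <;> simp [w] at h0 h1 h2 h3
  have hinj : Function.Injective fun i => Projectivization.mk ℂ (w i) (hw i) := by
    intro i j h
    obtain ⟨c, hc⟩ := (Projectivization.mk_eq_mk_iff' ℂ _ _ _ _).1 h
    have h0 := congrFun hc 0
    have h1 := congrFun hc 1
    have h2 := congrFun hc 2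
    have h3 := congrFun hc 3
    fin_cases i <;> fin_cases j <;> simp [w] at h0 h1 h2 h3 ⊢ <;> simp_all
  have hr : eightPoints = Set.range fun i => Projectivization.mk ℂ (w i) (hw i) := by
    ext P
    constructor
    · rintro ⟨v, hv, hv0, rfl⟩
      rcases hv with rfl | rfl | rfl | rfl | rfl | rfl | rfl | rfl
      · exact ⟨0, rfl⟩
      · exact ⟨1, rfl⟩
      · exact ⟨2, rfl⟩
      · exact ⟨3, rfl⟩
      · exact ⟨4, rfl⟩
      · exact ⟨5, rfl⟩
      · exact ⟨6, rfl⟩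
      · exact ⟨7, rfl⟩
    · rintro ⟨i, rfl⟩
      refine ⟨w i, ?_, hw i, rfl⟩
      fin_cases i <;> simp [w]
  rw [hr, Set.ncard_range_of_injective hinj, Nat.card_eq_fintype_card, Fintype.card_fin]

/-! ### Projection from the centre -/

theorem eval_smul_of_isHomogeneous {n d : ℕ} {g : MvPolynomial (Fin n) ℂ} (hg : g.IsHomogeneous d)
    (c : ℂ) (v : Fin n → ℂ) : eval (c • v) g = c ^ d * eval v g := by
  rw [eval_eq, eval_eq, Finset.mul_sum]
  refine Finset.sum_congr rfl fun m hm => ?_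
  have hd : ∑ i ∈ m.support, m i = d := (hg.degree_eq_sum_deg_support hm).symm
  simp only [Pi.smul_apply, smul_eq_mul, mul_pow, Finset.prod_mul_distrib]
  rw [Finset.prod_pow_eq_pow_sum, hd]
  ring

theorem eval_rep_mk_eq_zero_iff {n d : ℕ} {g : MvPolynomial (Fin n) ℂ} (hg : g.IsHomogeneous d)
    (v : Fin n → ℂ) (hv : v ≠ 0) :
    eval (Projectivization.mk ℂ v hv).rep g = 0 ↔ eval v g = 0 := by
  obtain ⟨c, hc⟩ := Projectivization.exists_smul_eq_mk_rep ℂ v hv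
  rw [← hc, Units.smul_def, eval_smul_of_isHomogeneous hg]
  simp

theorem isHomogeneous_quartic (k : ℂ) : (quartic k).IsHomogeneous 4 := by
  have hX : ∀ i : Fin 4, (X i : MvPolynomial (Fin 4) ℂ).IsHomogeneous 1 := isHomogeneous_X ℂ
  have hC : ∀ {m : ℕ} {p : MvPolynomial (Fin 4) ℂ} (c : ℂ), p.IsHomogeneous m →
      (C c * p).IsHomogeneous m := fun c h => h.C_mul c
  refine (((hC _ ?_).add (hC _ ?_)).sub (hC _ ?_)).add ?_
  · exact ((hX 0).pow 2).mul ((hX 1).pow 2)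
  · exact (((hX 0).mul (hX 1)).mul (hX 2)).mul (hX 3)
  · exact ((hX 2).pow 2).mul ((hX 3).pow 2)
  · exact (hC _ ((((hX 0).add (hX 1)).add (hX 2)).add (hX 3))).mul
      ((hC _ (((hX 2).mul (hX 3)).mul ((hX 0).add (hX 1)))).sub
        (hC _ (((hX 0).mul (hX 1)).mul ((hX 2).add (hX 3)))))

theorem isHomogeneous_sexticForms (k : ℂ) (i : Fin 3) :
    (sexticForms k i).IsHomogeneous (i + 1 : ℕ) := by
  have hX : ∀ i : Fin 6, (X i : MvPolynomial (Fin 6) ℂ).IsHomogeneous 1 := isHomogeneous_X ℂ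
  have hC : ∀ {m : ℕ} {p : MvPolynomial (Fin 6) ℂ} (c : ℂ), p.IsHomogeneous m →
      (C c * p).IsHomogeneous m := fun c h => h.C_mul c
  fin_cases i
  · exact (((((hX 0).add (hX 1)).add (hX 2)).add (hX 3)).add (hX 4)).add (hX 5)
  · exact (hC _ ((((hX 0).mul (hX 1)).add ((hX 0).mul (hX 2))).add ((hX 1).mul (hX 2)))).add
      (hC _ ((((hX 3).mul (hX 4)).add ((hX 3).mul (hX 5))).add ((hX 4).mul (hX 5))))
  · exact (hC _ (((hX 0).mul (hX 1)).mul (hX 2))).add (hC _ (((hX 3).mul (hX 4)).mul (hX 5)))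

/-- The line joining the centre to `y` contains `(v₀ : ⋯ : v₅)`, a point of the hyperplane other
than the centre, exactly when `y = (v₁ : v₂ : v₄ : v₅)`. -/
theorem projection_mk_iff {v : Fin 6 → ℂ} (hv : v ≠ 0)
    (hsum : v 0 + v 1 + v 2 + v 3 + v 4 + v 5 = 0) (y : Projectivization ℂ (Fin 4 → ℂ)) :
    (Projectivization.mk ℂ v hv ≠ centre ∧
      (Projectivization.mk ℂ v hv).submodule ≤ Submodule.span ℂ {centreVec, planeVec y.rep}) ↔
    ∃ h : ![v 1, v 2, v 4, v 5] ≠ 0, y = Projectivization.mk ℂ ![v 1, v 2, v 4, v 5] h := by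
  rw [Projectivization.submodule_mk, Submodule.span_singleton_le_iff_mem,
    Submodule.mem_span_pair]
  constructor
  · rintro ⟨hne, α, β, hαβ⟩
    have hβ : β ≠ 0 := by
      rintro rfl
      refine hne ((Projectivization.mk_eq_mk_iff' ℂ _ _ _ _).2 ⟨α, ?_⟩)
      rw [← hαβ, zero_smul, add_zero]
    have hr : β • y.rep = ![v 1, v 2, v 4, v 5] := by
      rw [← hαβ]
      funext j
      fin_cases j <;> simp [centreVec, planeVec]
    have hu : ![v 1, v 2, v 4, v 5] ≠ 0 := hr ▸ smul_ne_zero hβ y.rep_nonzero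
    refine ⟨hu, ?_⟩
    nth_rewrite 1 [← y.mk_rep]
    refine (Projectivization.mk_eq_mk_iff' ℂ _ _ _ _).2 ⟨β⁻¹, ?_⟩
    rw [← hr, inv_smul_smul₀ hβ]
  · rintro ⟨hu, rfl⟩
    obtain ⟨c, hc⟩ := Projectivization.exists_smul_eq_mk_rep ℂ _ hu
    constructor
    · intro h
      obtain ⟨t, ht⟩ := (Projectivization.mk_eq_mk_iff' ℂ _ _ _ _).1 h
      refine hu ?_
      rw [← ht]
      funext j
      fin_cases j <;> simp [centreVec]
    -- The plane point has first coordinate -(v₁+v₂+v₄+v₅)/2, and the multiple of the centre makes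
    -- up the difference to v₀; c⁻¹ undoes the choice of representative.
    · refine ⟨v 0 + (v 1 + v 2 + v 4 + v 5) / 2, (c : ℂ)⁻¹, ?_⟩
      have hplane : (c : ℂ)⁻¹ • planeVec (Projectivization.mk ℂ _ hu).rep =
          planeVec ![v 1, v 2, v 4, v 5] := by
        rw [← hc, Units.smul_def]
        have hc0 : (c : ℂ) ≠ 0 := c.ne_zero
        funext j
        fin_cases j <;> simp [planeVec] <;> field_simp
      rw [hplane]
      funext j
      fin_cases j <;> simp [planeVec, centreVec] <;>
        first | ring1 | linear_combination -hsum

theorem projectFromCentre_ninePoints : projectFromCentre ninePoints = eightPoints := by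
  ext y
  constructor
  · rintro ⟨x, ⟨v, ⟨i, j, rfl⟩, hv, rfl⟩, hx⟩
    obtain ⟨h, rfl⟩ := (projection_mk_iff hv (by
      fin_cases i <;> fin_cases j <;> simp [Fin.ext_iff]) y).1 hx
    rw [mk_mem_eightPoints_iff]
    -- The case i = j = 0 is the centre itself: its image vector is zero, against `h`.
    fin_cases i <;> fin_cases j <;> simp [Fin.ext_iff] at h ⊢
  · rintro ⟨w, hw, hw0, rfl⟩
    have key : ∀ (i j : Fin 3) (c : ℂ),
        c • ![(Pi.single (Fin.castAdd 3 i) 1 - Pi.single (Fin.natAdd 3 j) 1 : Fin 6 → ℂ) 1,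
          (Pi.single (Fin.castAdd 3 i) 1 - Pi.single (Fin.natAdd 3 j) 1 : Fin 6 → ℂ) 2,
          (Pi.single (Fin.castAdd 3 i) 1 - Pi.single (Fin.natAdd 3 j) 1 : Fin 6 → ℂ) 4,
          (Pi.single (Fin.castAdd 3 i) 1 - Pi.single (Fin.natAdd 3 j) 1 : Fin 6 → ℂ) 5] = w →
        Projectivization.mk ℂ w hw0 ∈ projectFromCentre ninePoints := by
      intro i j c hc
      set v : Fin 6 → ℂ := Pi.single (Fin.castAdd 3 i) 1 - Pi.single (Fin.natAdd 3 j) 1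
      have hv : v ≠ 0 := by
        intro h
        have := congrFun h (Fin.castAdd 3 i)
        fin_cases i <;> fin_cases j <;> simp [v, Fin.ext_iff] at this
      have hu : ![v 1, v 2, v 4, v 5] ≠ 0 := by
        intro h
        rw [h, smul_zero] at hc
        exact hw0 hc.symm
      refine ⟨_, ⟨v, ⟨i, j, rfl⟩, hv, rfl⟩, (projection_mk_iff hv ?_ _).2 ⟨hu, ?_⟩⟩
      · fin_cases i <;> fin_cases j <;> simp [v, Fin.ext_iff]
      · exact (Projectivization.mk_eq_mk_iff' ℂ _ _ _ _).2 ⟨c, hc⟩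
    rcases hw with rfl | rfl | rfl | rfl | rfl | rfl | rfl | rfl
    · refine key 1 0 1 ?_
      funext j; fin_cases j <;> simp [Fin.ext_iff]
    · refine key 2 0 1 ?_
      funext j; fin_cases j <;> simp [Fin.ext_iff]
    · refine key 0 1 (-1) ?_
      funext j; fin_cases j <;> simp [Fin.ext_iff]
    · refine key 0 2 (-1) ?_
      funext j; fin_cases j <;> simp [Fin.ext_iff]
    · refine key 1 1 1 ?_
      funext j; fin_cases j <;> simp [Fin.ext_iff]
    · refine key 1 2 1 ?_
      funext j; fin_cases j <;> simp [Fin.ext_iff]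
    · refine key 2 1 1 ?_
      funext j; fin_cases j <;> simp [Fin.ext_iff]
    · refine key 2 2 1 ?_
      funext j; fin_cases j <;> simp [Fin.ext_iff]

/-- Elimination of the sixth coordinate: the quartic is the resultant of the quadric and
the cubic on the hyperplane. -/
theorem eval_quartic_eq_resultant (k : ℂ) {v : Fin 6 → ℂ}
    (hsum : v 0 + v 1 + v 2 + v 3 + v 4 + v 5 = 0) :
    eval ![v 1, v 2, v 4, v 5] (quartic k) =
      ((1 + k) ^ 2 * (v 1 * v 2) - (1 - k) ^ 2 * (v 4 * v 5)) * eval v (sexticForms k 1) -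
      ((1 + k) * (v 1 + v 2) - (1 - k) * (v 4 + v 5)) * eval v (sexticForms k 2) := by
  obtain h3 : v 3 = -(v 0 + v 1 + v 2 + v 4 + v 5) := by linear_combination hsum
  rw [eval_quartic]
  simp [sexticForms, h3]
  ring

/-- The linear form whose zero plane contains the projection of the tangent cone at the centre. -/
def tangentForm (k : ℂ) : MvPolynomial (Fin 4) ℂ :=
  C (1 + k) * (X 0 + X 1) - C (1 - k) * (X 2 + X 3)

theorem eval_tangentForm (k : ℂ) (y : Fin 4 → ℂ) :
    eval y (tangentForm k) = (1 + k) * (y 0 + y 1) - (1 - k) * (y 2 + y 3) := by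
  simp [tangentForm]

theorem irreducible_tangentForm {k : ℂ} (hk' : k ≠ -1) : Irreducible (tangentForm k) := by
  have ha : 1 + k ≠ 0 := fun h => hk' (by linear_combination h)
  have hX : ∀ i : Fin 4, (X i : MvPolynomial (Fin 4) ℂ).IsHomogeneous 1 := isHomogeneous_X ℂ
  have hhom : (tangentForm k).IsHomogeneous 1 :=
    (((hX 0).add (hX 1)).C_mul _).sub (((hX 2).add (hX 3)).C_mul _)
  have h0 : tangentForm k ≠ 0 := by
    intro h
    have := congrArg (eval (![1, 0, 0, 0] : Fin 4 → ℂ)) h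
    rw [eval_tangentForm] at this
    simp [ha] at this
  refine irreducible_of_totalDegree_eq_one (hhom.totalDegree h0) fun x hx => ?_
  rw [isUnit_iff_ne_zero]
  rintro rfl
  refine h0 ?_
  ext m
  rw [coeff_zero]
  exact zero_dvd_iff.1 (hx m)

/-- The value t solves the quadric for x₁, where it occurs with coefficient `tangentForm`. The
resultant identity then forces the cubic to vanish, again because that coefficient is nonzero. -/
theorem mk_mem_projectFromCentre {k : ℂ} {y : Fin 4 → ℂ} (hy : y ≠ 0)
    (hf : eval y (quartic k) = 0) (hA : eval y (tangentForm k) ≠ 0) :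
    Projectivization.mk ℂ y hy ∈ projectFromCentre (projZeros (sexticForms k)) := by
  have hA' : (1 + k) * (y 0 + y 1) - (1 - k) * (y 2 + y 3) ≠ 0 := by
    rwa [← eval_tangentForm]
  set s := y 0 + y 1 + y 2 + y 3 with hs
  set t := ((1 - k) * s * (y 2 + y 3) - (1 + k) * (y 0 * y 1) - (1 - k) * (y 2 * y 3)) /
    ((1 + k) * (y 0 + y 1) - (1 - k) * (y 2 + y 3)) with ht
  have htA := div_mul_cancel₀
    ((1 - k) * s * (y 2 + y 3) - (1 + k) * (y 0 * y 1) - (1 - k) * (y 2 * y 3)) hA'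
  rw [← ht] at htA
  let v : Fin 6 → ℂ := ![t, y 0, y 1, -t - s, y 2, y 3]
  have hvy : ![v 1, v 2, v 4, v 5] = y := by
    funext j; fin_cases j <;> rfl
  have hv : v ≠ 0 := by
    intro h
    refine hy ?_
    rw [← hvy, h]
    funext j; fin_cases j <;> rfl
  have hsum : v 0 + v 1 + v 2 + v 3 + v 4 + v 5 = 0 := by
    simp [v, hs]; ring
  have hquad : eval v (sexticForms k 1) = 0 := by
    simp [sexticForms, v]
    linear_combination htA
  have hcub : eval v (sexticForms k 2) = 0 := by
    have := eval_quartic_eq_resultant k hsum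
    rw [hvy, hf, hquad] at this
    have hA'' : (1 + k) * (v 1 + v 2) - (1 - k) * (v 4 + v 5) ≠ 0 := hA'
    refine (mul_eq_zero.1 ?_).resolve_left hA''
    linear_combination this
  refine ⟨Projectivization.mk ℂ v hv, ?_, (projection_mk_iff hv hsum _).2 ⟨hvy ▸ hy, ?_⟩⟩
  · intro i
    rw [eval_rep_mk_eq_zero_iff (isHomogeneous_sexticForms k i)]
    fin_cases i
    · simpa [sexticForms] using hsum
    · exact hquad
    · exact hcub
  · congr 1
    exact hvy.symm

/-- If g vanishes on the image, then `tangentForm k * g` vanishes on the whole quartic, so f_k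
divides a power of it. Coprimality removes the factor `tangentForm`, and irreducibility of f_k is
not needed. -/
theorem zariskiClosure_projection {k : ℂ} (hk' : k ≠ -1) :
    zariskiClosure (projectFromCentre (projZeros (sexticForms k))) = projZeros ![quartic k] := by
  have ha : 1 + k ≠ 0 := fun h => hk' (by linear_combination h)
  ext P
  constructor
  · intro hP i
    fin_cases i
    refine hP 4 (quartic k) (isHomogeneous_quartic k) ?_
    rintro Q ⟨x, hx, hxQ⟩
    rw [← x.mk_rep] at hxQ
    have hsum : x.rep 0 + x.rep 1 + x.rep 2 + x.rep 3 + x.rep 4 + x.rep 5 = 0 := by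
      simpa [sexticForms] using hx 0
    obtain ⟨h, rfl⟩ := (projection_mk_iff x.rep_nonzero hsum Q).1 hxQ
    rw [eval_rep_mk_eq_zero_iff (isHomogeneous_quartic k), eval_quartic_eq_resultant k hsum,
      hx 1, hx 2]
    ring
  · intro hP d g hg hS
    have hfP : eval P.rep (quartic k) = 0 := hP 0
    have hvan : ∀ y : Fin 4 → ℂ, eval y (quartic k) = 0 → eval y (tangentForm k * g) = 0 := by
      intro y hy
      rw [map_mul]
      by_cases hA : eval y (tangentForm k) = 0
      · rw [hA, zero_mul]
      · have hy0 : y ≠ 0 := by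
          rintro rfl
          exact hA (by rw [eval_tangentForm]; simp)
        rw [(eval_rep_mk_eq_zero_iff hg y hy0).1 (hS _ (mk_mem_projectFromCentre hy0 hy hA)),
          mul_zero]
    have hmem : tangentForm k * g ∈ (Ideal.span {quartic k}).radical := by
      rw [← vanishingIdeal_zeroLocus_eq_radical (K := ℂ), mem_vanishingIdeal_iff]
      intro y hy
      rw [mem_zeroLocus_iff] at hy
      rw [aeval_eq_eval]
      exact hvan y (by simpa [aeval_eq_eval] using hy _ (Ideal.mem_span_singleton_self _))
    obtain ⟨n, hn⟩ := hmem
    rw [Ideal.mem_span_singleton, mul_pow] at hn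
    have hrel : IsRelPrime (tangentForm k) (quartic k) := by
      rw [(irreducible_tangentForm hk').isRelPrime_iff_not_dvd]
      rintro ⟨q, hq⟩
      -- At this point `tangentForm` vanishes while f_k = (1+k)³.
      have := congrArg (eval (![1, -1, 0, 0] : Fin 4 → ℂ)) hq
      rw [map_mul, eval_quartic, eval_tangentForm] at this
      simp [ha] at this
    obtain ⟨q, hq⟩ := (hrel.symm.pow_right (n := n)).dvd_of_dvd_mul_left hn
    have := congrArg (eval P.rep) hq
    rw [map_mul, hfP, zero_mul, map_pow] at this
    exact eq_zero_of_pow_eq_zero this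

end

theorem mainTheorem7 (k : ℂ) (hk : k ≠ 1) (hk' : k ≠ -1) :
    -- the quartic is the projection of the sextic from a cusp, and the other eight
    -- distinguished points of the sextic go to the eight specified points
    IsA2Cusp (r := 2) (sexticForms k) centre ∧
    (quartic k).IsHomogeneous 4 ∧
    zariskiClosure (projectFromCentre (projZeros (sexticForms k))) = projZeros ![quartic k] ∧
    projectFromCentre ninePoints = eightPoints ∧
    -- the singularities are exactly the eight specified ones
    singularPoints (quartic k) = eightPoints ∧
    eightPoints.ncard = 8 ∧
    -- and each of them is a cusp, satisfying the semi-quasihomogeneous criterion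
    ∀ P ∈ eightPoints, SatisfiesSQHCriterion (quartic k) P ∧ IsA2Cusp (r := 0) ![quartic k] P := by
  exact ⟨isA2Cusp_centre hk hk', isHomogeneous_quartic k, zariskiClosure_projection hk',
    projectFromCentre_ninePoints, singularPoints_quartic hk hk', ncard_eightPoints, fun P hP =>
    ⟨quartic_sqh_of_mem_eightPoints hk hk' hP,
      (quartic_sqh_of_mem_eightPoints hk hk' hP).isA2Cusp⟩⟩
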